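/- Let $\mathbf{GLP}$ be the propositional modal logic with modalities $[0],[1],[2],\dots$ over countably many propositional variables, where $\langle n\rangle\varphi:=\neg[n]\neg\varphi$, whose axioms are all Boolean tautologies, $[n](\varphi\to\psi)\to([n]\varphi\to[n]\psi)$, $[n]([n]\varphi\to\varphi)\to[n]\varphi$, and, for $m<n$, $[m]\varphi\to[n]\varphi$ and $\langle m\rangle\varphi\to[n]\langle m\rangle\varphi$, and whose rules are modus ponens and necessitation $\varphi/[n]\varphi$. For a topology $\tau$ on $X$ let $d_\tau(A)$ denote the set of limit points of $A\subseteq X$. The logic $\mathrm{Log}(X)$ of a polytopological space $X=(X,\tau_0,\tau_1,\dots)$ is the set of formulas $\varphi$ with $v(\varphi)=X$ for all valuations $v$ of the variables by subsets of $X$, where $v$ commutes with the Boolean connectives and $v(\langle n\rangle\varphi)=d_{\tau_n}(v(\varphi))$, that is, $v([n]\varphi)=X\setminus d_{\tau_n}(X\setminus v(\varphi))$. A topology $\tau$ on $X$ is scattered if every nonempty subspace has an isolated point. Then let $d^0X=X$, $d^{\alpha+1}X=d_\tau(d^\alpha X)$, $d^\lambda X=\bigcap_{\alpha<\lambda}d^\alpha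 X$ for limit $\lambda$, and let $\rho_\tau(x)=\min\{\alpha: x\notin d^{\alpha+1}X\}$. A topology $\sigma\supseteq\tau$ is an $\ell$-extension of $\tau$ if $\rho_\sigma=\rho_\tau$ and, for every $U\in\sigma$ and every $x\in U$ such that $\rho_\tau(x)$ is not a limit ordinal, there is $V\in\tau$ with $x\in V\subseteq U$. A scattered topology is $\ell$-maximal if it has no proper $\ell$-extension. Let $\tau^+$ be the topology generated by $\tau$ and all sets $d_\tau(A)$, $A\subseteq X$. A polytopological space $(X,\tau_0,\tau_1,\dots)$ is an lme-space based on a scattered topology $\tau$ if $\tau_0$ is an $\ell$-maximal $\ell$-extension of $\tau$ and, for each $n$, $\tau_{n+1}$ is an $\ell$-maximal $\ell$-extension of $\tau_n^+$. It is an ordinal lme-space if $X$ is an ordinal and $\tau$ is its order topology. Theorem. There is an ordinal lme-space $X=(\varepsilon_0,\tau_0,\tau_1,\dots)$, with underlying set the ordinal $\varepsilon_0$ (the least ordinal $\alpha$ with $\omega^\alpha=\alpha$), such that $\mathrm{Log}(X)=\mathbf{GLP}$. -/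

import Mathlib

open scoped Topology

/-! ### The logic GLP -/

/-- Modal formulas over countably many propositional variables, with modalities `[n]`, `n : ℕ`.
The other connectives are the usual Boolean abbreviations. -/
inductive ModalFormula : Type
  | var : ℕ → ModalFormula
  | bot : ModalFormula
  | imp : ModalFormula → ModalFormula → ModalFormula
  | box : ℕ → ModalFormula → ModalFormula

namespace ModalFormula

/-- Negation `¬φ`. -/
def neg (φ : ModalFormula) : ModalFormula := imp φ bot

/-- `⟨n⟩φ := ¬[n]¬φ`. -/
def dia (n : ℕ) (φ : ModalFormula) : ModalFormula := neg (box n (neg φ))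

/-- `φ` is (a substitution instance of) a Boolean tautology: it is true under every assignment of
truth values to formulas that respects the Boolean connectives (variables and boxed formulas are
treated as atoms). -/
def IsTautology (φ : ModalFormula) : Prop :=
  ∀ e : ModalFormula → Prop, ¬ e bot → (∀ ψ χ, e (imp ψ χ) ↔ (e ψ → e χ)) → e φ

end ModalFormula

open ModalFormula in
/-- Provability in Japaridze's logic GLP. -/
inductive GLPProvable : ModalFormula → Prop
  | taut {φ : ModalFormula} : IsTautology φ → GLPProvable φ
  | distr (n : ℕ) (φ ψ : ModalFormula) :
      GLPProvable (imp (box n (imp φ ψ)) (imp (box n φ) (box n ψ)))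
  | loeb (n : ℕ) (φ : ModalFormula) :
      GLPProvable (imp (box n (imp (box n φ) φ)) (box n φ))
  | mono {m n : ℕ} (hmn : m < n) (φ : ModalFormula) :
      GLPProvable (imp (box m φ) (box n φ))
  | negIntro {m n : ℕ} (hmn : m < n) (φ : ModalFormula) :
      GLPProvable (imp (dia m φ) (box n (dia m φ)))
  | mp {φ ψ : ModalFormula} : GLPProvable φ → GLPProvable (imp φ ψ) → GLPProvable ψ
  | nec (n : ℕ) {φ : ModalFormula} : GLPProvable φ → GLPProvable (box n φ)

/-- The set of theorems of GLP. -/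
def GLP : Set ModalFormula := {φ | GLPProvable φ}

/-! ### Neighborhood and topological semantics -/

/-- The value of a formula in the neighborhood frame `(X, δ 0, δ 1, …)` under the valuation `v` of
the variables; `⟨n⟩` is interpreted by `δ n` and `[n]` by the dual operator. -/
def ModalFormula.value {X : Type*} (δ : ℕ → Set X → Set X) (v : ℕ → Set X) :
    ModalFormula → Set X
  | .var p => v p
  | .bot => ∅
  | .imp φ ψ => (φ.value δ v)ᶜ ∪ ψ.value δ v
  | .box n φ => (δ n (φ.value δ v)ᶜ)ᶜ

/-- The logic of a neighborhood frame: all formulas valid in it. -/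
def frameLog {X : Type*} (δ : ℕ → Set X → Set X) : Set ModalFormula :=
  {φ | ∀ v : ℕ → Set X, φ.value δ v = Set.univ}

/-- The derived set operator `d_τ` of the topology `τ`. -/
def derivOp {X : Type*} (τ : TopologicalSpace X) (A : Set X) : Set X :=
  @derivedSet X τ A

/-- The logic `Log(X)` of a polytopological space `(X, τ 0, τ 1, …)`. -/
def topLog {X : Type*} (τ : ℕ → TopologicalSpace X) : Set ModalFormula :=
  frameLog fun n => derivOp (τ n)

/-! ### Scattered spaces, ranks, ℓ-maximal topologies -/

/-- `(X, τ)` is scattered: every nonempty subspace has an isolated point. -/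
def IsScattered {X : Type*} (τ : TopologicalSpace X) : Prop :=
  ∀ A : Set X, A.Nonempty → ∃ x ∈ A, ∃ U : Set X, IsOpen[τ] U ∧ U ∩ A = {x}

/-- The `α`-th Cantor–Bendixson derivative `d^α X` of the whole space. (All members of the sequence
are closed, so the relative derived sets iterated by Mathlib are the derived sets.) -/
noncomputable def cbDeriv {X : Type*} (τ : TopologicalSpace X) (α : Ordinal) : Set X :=
  @CantorBendixson.iteratedDerivedSet X τ Set.univ α

/-- The Cantor–Bendixson rank function `ρ_τ(x) = min {α | x ∉ d^(α+1) X}` (used for scattered `τ`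
only, where the minimum exists). -/
noncomputable def cbRank {X : Type*} (τ : TopologicalSpace X) (x : X) : Ordinal :=
  sInf {α | x ∉ cbDeriv τ (α + 1)}

/-- `σ` is an ℓ-extension of `τ`: it is finer, has the same rank function, and the identity
`(X, τ) → (X, σ)` is continuous at all points of non-limit rank. (In Mathlib's order on topologies,
`σ ≤ τ` says that every `τ`-open set is `σ`-open; `0` is not an `Order.IsSuccLimit`.) -/
structure IsLExtension {X : Type*} (τ σ : TopologicalSpace X) : Prop where
  le : σ ≤ τ
  rank_eq : ∀ x, cbRank σ x = cbRank τ x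
  nonlimit : ∀ U : Set X, IsOpen[σ] U → ∀ x ∈ U, ¬ Order.IsSuccLimit (cbRank τ x) →
    ∃ V : Set X, IsOpen[τ] V ∧ x ∈ V ∧ V ⊆ U

/-- `τ` is ℓ-maximal: it has no proper ℓ-extension. -/
def IsLMaximal {X : Type*} (τ : TopologicalSpace X) : Prop :=
  ∀ σ : TopologicalSpace X, IsLExtension τ σ → σ = τ

/-- The next topology `τ⁺`, generated by `τ` and all the derived sets `d_τ(A)`. -/
abbrev plusTopology {X : Type*} (τ : TopologicalSpace X) : TopologicalSpace X :=
  TopologicalSpace.generateFrom ({U | IsOpen[τ] U} ∪ Set.range (derivOp τ))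

/-- `(X, τ 0, τ 1, …)` is an lme-space based on the scattered topology `τb`. -/
structure IsLmeSpace {X : Type*} (τb : TopologicalSpace X) (τ : ℕ → TopologicalSpace X) :
    Prop where
  scattered : IsScattered τb
  zero_ext : IsLExtension τb (τ 0)
  zero_max : IsLMaximal (τ 0)
  succ_ext : ∀ n, IsLExtension (plusTopology (τ n)) (τ (n + 1))
  succ_max : ∀ n, IsLMaximal (τ (n + 1))

/-- An ordinal lme-space with underlying ordinal `o`: an lme-space based on the order topology
of `o`. Here `o.ToType` is the well-ordered set of all ordinals below `o`. -/
def IsOrdinalLmeSpace (o : Ordinal) (τ : ℕ → TopologicalSpace o.ToType) : Prop :=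
  IsLmeSpace (Preorder.topology o.ToType) τ

/-!
Soundness holds for all lme-spaces. In a scattered space `d (A \ d A) = d A`, which is Löb's law,
and the topologies increase in such a way that every set `d_m A` is open in `τ n` for `m < n`.

For completeness, recall that the rank function of the order topology on an ordinal is the
end-logarithm. By ℓ-maximality the rank function of `τ n` is a d-map from `(τ n)⁺` to the ordinals:
if `x ∈ d_n A`, the points near `x` of large enough rank lie in `d_n A`, since otherwise the
ℓ-extension could be refined at `x`. Hence an lme-space based on an ordinal carries d-maps `r n` to
the ordinals such that `r (n + 1)` is the end-logarithm of `r n`, and formulas can be refuted by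
labelling ordinals below `ε₀` with points of the canonical model and pulling the labels back along
`r 0`.

By induction on decreasing `n`, every point `w` of the canonical model labels the endpoint of an
interval `(0, l]` whose labelling is correct for the modalities from `n` on. If `w` refutes
some formulas `[n]ψ`, then concatenated realizations of `n`-successors of `w`, each one refuting
fewer such formulas, form a block of some length `k` that contains a witness for every `ψ`. Copies
of this block fill the points with end-logarithm at most `log ω k` and accumulate at all others. The
latter are labelled, through their end-logarithm, by a realization of `w` for the modalities from
`n + 1` on; all of these labels agree with `w` on the formulas `[n]ψ`.
-/

universe u

/-! ### End-logarithms of ordinals -/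

section EndLog

open Ordinal

variable {α β δ ξ : Ordinal.{u}}

/-- The end-logarithm: the exponent of the last term of the Cantor normal form of `α` in base `ω`,
with `endLog 0 = 0`. It is the Cantor–Bendixson rank function of the order topology. -/
noncomputable def endLog (α : Ordinal.{u}) : Ordinal.{u} :=
  sInf {β | ∃ δ, α = δ + ω ^ β}

theorem exists_eq_add_omega0_opow (hα : α ≠ 0) : ∃ δ β : Ordinal, α = δ + ω ^ β := by
  induction α using WellFoundedLT.induction with
  | ind α ih =>
    have hsplit : ω ^ log ω α + (α - ω ^ log ω α) = α :=
      Ordinal.add_sub_cancel_of_le (opow_log_le_self ω hα)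
    rcases eq_or_ne (α - ω ^ log ω α) 0 with hr | hr
    · exact ⟨0, log ω α, by rw [zero_add, ← add_zero (ω ^ log ω α), ← hr, hsplit]⟩
    · obtain ⟨δ, β, hδ⟩ := ih _ (sub_omega0_opow_log_lt hα) hr
      exact ⟨ω ^ log ω α + δ, β, by rw [add_assoc, ← hδ, hsplit]⟩

theorem omega0_opow_exponent_unique {δ' β' : Ordinal.{u}} (h : δ + ω ^ β = δ' + ω ^ β') :
    β = β' := by
  wlog hle : δ ≤ δ' generalizing δ δ' β β'
  · exact (this h.symm (le_of_not_ge hle)).symm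
  obtain ⟨η, rfl⟩ := exists_add_of_le hle
  replace h : ω ^ β = η + ω ^ β' := by rwa [add_assoc, add_right_inj] at h
  rcases (h ▸ le_self_add : η ≤ ω ^ β).lt_or_eq with hη | rfl
  · have : η + ω ^ β = η + ω ^ β' := by rw [add_omega0_opow hη, h]
    exact (opow_right_inj one_lt_omega0).1 ((add_right_inj η).1 this)
  · exact absurd (left_eq_add.1 h) (opow_pos _ omega0_pos).ne'

theorem endLog_add_omega0_opow (δ β : Ordinal.{u}) : endLog (δ + ω ^ β) = β := by
  have : {β' | ∃ δ', δ + ω ^ β = δ' + ω ^ β'} = {β} :=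
    Set.eq_singleton_iff_unique_mem.2
      ⟨⟨δ, rfl⟩, fun _ ⟨_, h⟩ => (omega0_opow_exponent_unique h).symm⟩
  rw [endLog, this, csInf_singleton]

theorem endLog_omega0_opow (β : Ordinal.{u}) : endLog (ω ^ β) = β := by
  simpa using endLog_add_omega0_opow 0 β

theorem endLog_zero : endLog (0 : Ordinal.{u}) = 0 := by
  have : {β : Ordinal.{u} | ∃ δ, 0 = δ + ω ^ β} = ∅ :=
    Set.eq_empty_of_forall_notMem fun β ⟨_, h⟩ =>
      (opow_pos β omega0_pos).ne' (Ordinal.add_eq_zero_iff.1 h.symm).2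
  rw [endLog, this, Ordinal.sInf_empty]

theorem exists_eq_add_omega0_opow_endLog (hα : α ≠ 0) : ∃ δ, α = δ + ω ^ endLog α := by
  obtain ⟨δ, β, rfl⟩ := exists_eq_add_omega0_opow hα
  exact ⟨δ, by rw [endLog_add_omega0_opow]⟩

theorem endLog_add (γ : Ordinal.{u}) (hξ : ξ ≠ 0) : endLog (γ + ξ) = endLog ξ := by
  obtain ⟨δ, β, rfl⟩ := exists_eq_add_omega0_opow hξ
  rw [← add_assoc, endLog_add_omega0_opow, endLog_add_omega0_opow]

theorem omega0_opow_endLog_le (hξ : ξ ≠ 0) : ω ^ endLog ξ ≤ ξ := by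
  obtain ⟨δ, hδ⟩ := exists_eq_add_omega0_opow_endLog hξ
  exact le_add_self.trans_eq hδ.symm

theorem endLog_lt (hξ : ξ ≠ 0) (h : ξ < ω ^ β) : endLog ξ < β :=
  (opow_lt_opow_iff_right one_lt_omega0).1 ((omega0_opow_endLog_le hξ).trans_lt h)

theorem endLog_le_log (hξ : ξ ≠ 0) (h : ξ ≤ α) : endLog ξ ≤ log ω α :=
  (opow_le_iff_le_log one_lt_omega0 ((pos_iff_ne_zero.2 hξ).trans_le h).ne').1
    ((omega0_opow_endLog_le hξ).trans h)

theorem exists_forall_endLog_lt (hα : α ≠ 0) :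
    ∃ δ < α, ∀ ξ, δ < ξ → ξ < α → endLog ξ < endLog α := by
  obtain ⟨δ, hδ⟩ := exists_eq_add_omega0_opow_endLog hα
  refine ⟨δ, hδ ▸ lt_add_of_pos_right δ (opow_pos _ omega0_pos), fun ξ hδξ hξα => ?_⟩
  obtain ⟨η, rfl⟩ := exists_add_of_le hδξ.le
  have hη : η ≠ 0 := by rintro rfl; simp at hδξ
  rw [endLog_add δ hη]
  exact endLog_lt hη (lt_of_add_lt_add_left (hξα.trans_eq hδ))

theorem exists_endLog_eq (hδ : δ < α) (hβ : β < endLog α) :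
    ∃ ξ, δ < ξ ∧ ξ < α ∧ endLog ξ = β := by
  obtain ⟨γ, hγ⟩ := exists_eq_add_omega0_opow_endLog (pos_of_gt hδ).ne'
  have hmax : max δ γ < α := max_lt hδ (hγ ▸ lt_add_of_pos_right γ (opow_pos _ omega0_pos))
  refine ⟨max δ γ + ω ^ β,
    (le_max_left δ γ).trans_lt (lt_add_of_pos_right _ (opow_pos _ omega0_pos)), ?_,
    endLog_add_omega0_opow _ β⟩
  obtain ⟨η, hη⟩ := exists_add_of_le (le_max_right δ γ)
  have hηlt : η < ω ^ endLog α := lt_of_add_lt_add_left (hη ▸ hmax.trans_eq hγ)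
  have hβlt : ω ^ β < ω ^ endLog α := (opow_lt_opow_iff_right one_lt_omega0).2 hβ
  calc max δ γ + ω ^ β = γ + (η + ω ^ β) := by rw [hη, add_assoc]
    _ < γ + ω ^ endLog α :=
      add_lt_add_right (isPrincipal_add_omega0_opow _ hηlt hβlt) γ
    _ = α := hγ.symm

end EndLog

/-! ### Blocks of ordinals -/

section Blocks

open Ordinal Order

variable {δ κ q η ξ : Ordinal.{u}}

theorem endLog_mul_add_le (hη : 0 < η) (h : η ≤ κ) : endLog (κ * q + η) ≤ log ω κ := by
  rw [endLog_add _ hη.ne']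
  exact endLog_le_log hη.ne' h

theorem log_lt_endLog_mul (hκ : κ ≠ 0) (hq : IsSuccLimit q) : log ω κ < endLog (κ * q) := by
  obtain ⟨c, rfl⟩ := isSuccPrelimit_iff_omega0_dvd.1 hq.isSuccPrelimit
  obtain ⟨δ, β, rfl⟩ := exists_eq_add_omega0_opow (right_ne_zero_of_mul hq.ne_bot)
  have hκω : κ * ω = ω ^ succ (log ω κ) :=
    mul_eq_opow_log_succ hκ isPrincipal_mul_omega0 (natCast_lt_omega0 2)
  have hlast : endLog (κ * (ω * (δ + ω ^ β))) = succ (log ω κ) + β := by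
    rw [← mul_assoc, hκω, mul_add, ← opow_add, endLog_add_omega0_opow]
  exact (lt_succ _).trans_le (hlast ▸ le_self_add)

theorem exists_mul_add_or_isSuccLimit_mul (hκ : κ ≠ 0) (hξ : ξ ≠ 0) :
    (∃ q η, 0 < η ∧ η ≤ κ ∧ ξ = κ * q + η) ∨ ∃ q, IsSuccLimit q ∧ ξ = κ * q := by
  by_cases hm : ξ % κ = 0
  · obtain ⟨q, rfl⟩ := dvd_of_mod_eq_zero hm
    rcases zero_or_succ_or_isSuccLimit q with rfl | ⟨p, rfl⟩ | hq
    · exact absurd (mul_zero κ) hξ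
    · exact .inl ⟨p, κ, pos_iff_ne_zero.2 hκ, le_rfl, mul_succ κ p⟩
    · exact .inr ⟨q, hq, rfl⟩
  · exact .inl ⟨ξ / κ, ξ % κ, pos_iff_ne_zero.2 hm, (mod_lt ξ hκ).le, (div_add_mod ξ κ).symm⟩

theorem exists_mul_add_of_endLog_le (hκ : κ ≠ 0) (hξ : ξ ≠ 0) (h : endLog ξ ≤ log ω κ) :
    ∃ q η, 0 < η ∧ η ≤ κ ∧ ξ = κ * q + η := by
  refine (exists_mul_add_or_isSuccLimit_mul hκ hξ).resolve_right ?_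
  rintro ⟨q, hq, rfl⟩
  exact h.not_gt (log_lt_endLog_mul hκ hq)

theorem exists_mul_add_mem_Ioc (hκ : κ ≠ 0) (h : log ω κ < endLog ξ) (hδ : δ < ξ) (hη : η ≤ κ) :
    ∃ q, κ * q + η ∈ Set.Ioc δ ξ := by
  rcases exists_mul_add_or_isSuccLimit_mul hκ (pos_of_gt hδ).ne' with
    ⟨q, η', h0, h1, rfl⟩ | ⟨q, hq, rfl⟩
  · exact absurd h (endLog_mul_add_le h0 h1).not_gt
  · obtain ⟨p, hpq, hp⟩ := (lt_mul_iff_of_isSuccLimit hq).1 hδ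
    refine ⟨p, hp.trans_le le_self_add, ?_⟩
    calc κ * p + η ≤ κ * p + κ := by gcongr
      _ = κ * succ p := (mul_succ κ p).symm
      _ ≤ κ * q := by gcongr; exact succ_le_of_lt hpq

/-- The position in `(0, κ]` of `ξ` inside its block `(κ * q, κ * q + κ]`. -/
noncomputable def blockPos (κ ξ : Ordinal.{u}) : Ordinal.{u} :=
  if ξ % κ = 0 then κ else ξ % κ

theorem blockPos_mul_add (h0 : 0 < η) (h : η ≤ κ) : blockPos κ (κ * q + η) = η := by
  rcases h.lt_or_eq with hlt | rfl
  · rw [blockPos, mul_add_mod_self, mod_eq_of_lt hlt, if_neg h0.ne']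
  · rw [blockPos, mul_add_mod_self, mod_self, if_pos rfl]

end Blocks

section EpsilonZero

open Ordinal

variable {α β : Ordinal.{u}}

theorem omega0_opow_lt_epsilon_zero (h : α < ε₀) : ω ^ α < ε₀ :=
  ((opow_lt_opow_iff_right one_lt_omega0).2 h).trans_eq (omega0_opow_epsilon 0)

theorem add_lt_epsilon_zero (hα : α < ε₀) (hβ : β < ε₀) : α + β < ε₀ := by
  have h := isPrincipal_add_omega0_opow ε₀
  rw [omega0_opow_epsilon] at h
  exact h hα hβ

end EpsilonZero

/-! ### Scattered spaces and their rank functions -/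

section Scattered

open Order

variable {X : Type u} {τ σ : TopologicalSpace X} {ρ : X → Ordinal.{u}} {A U : Set X} {x : X}
  {α : Ordinal.{u}}

theorem mem_derivOp_iff :
    x ∈ derivOp τ A ↔ ∀ U, IsOpen[τ] U → x ∈ U → ∃ y ∈ U, y ∈ A ∧ y ≠ x := by
  let _ := τ
  change AccPt x (Filter.principal A) ↔ _
  rw [accPt_iff_nhds]
  constructor
  · intro h U hU hx
    obtain ⟨y, ⟨hyU, hyA⟩, hne⟩ := h U (hU.mem_nhds hx)
    exact ⟨y, hyU, hyA, hne⟩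
  · intro h U hU
    obtain ⟨V, hVU, hV, hxV⟩ := mem_nhds_iff.1 hU
    obtain ⟨y, hyV, hyA, hne⟩ := h V hV hxV
    exact ⟨y, ⟨hVU hyV, hyA⟩, hne⟩

theorem derivOp_mono {B : Set X} (h : A ⊆ B) : derivOp τ A ⊆ derivOp τ B :=
  @derivedSet_mono X τ A B h

theorem derivOp_anti (h : σ ≤ τ) (A : Set X) : derivOp σ A ⊆ derivOp τ A := fun _ hx =>
  mem_derivOp_iff.2 fun U hU hxU => mem_derivOp_iff.1 hx U (h U hU) hxU

theorem derivOp_empty (τ : TopologicalSpace X) : derivOp τ ∅ = ∅ := by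
  ext x
  simpa [mem_derivOp_iff] using ⟨Set.univ, τ.isOpen_univ, trivial⟩

theorem derivOp_union (τ : TopologicalSpace X) (A B : Set X) :
    derivOp τ (A ∪ B) = derivOp τ A ∪ derivOp τ B :=
  @derivedSet_union X τ A B

theorem notMem_derivOp_iff :
    x ∉ derivOp τ A ↔ ∃ U, IsOpen[τ] U ∧ x ∈ U ∧ ∀ y ∈ U, y ∈ A → y = x := by
  rw [mem_derivOp_iff]
  push Not
  rfl

theorem mem_derivOp_congr {B : Set X} (hU : IsOpen[τ] U) (hx : x ∈ U)
    (h : ∀ y ∈ U, (y ∈ A ↔ y ∈ B)) : x ∈ derivOp τ A ↔ x ∈ derivOp τ B := by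
  let _ := τ
  simp only [derivOp, mem_derivedSet, accPt_iff_frequently_nhdsNE]
  exact Filter.frequently_congr
    (eventually_nhdsWithin_of_eventually_nhds ((hU.eventually_mem hx).mono h))

theorem cbDeriv_zero : cbDeriv τ 0 = Set.univ :=
  @CantorBendixson.iteratedDerivedSet_zero X τ Set.univ

theorem cbDeriv_add_one (α : Ordinal.{u}) : cbDeriv τ (α + 1) = derivOp τ (cbDeriv τ α) := by
  let _ := τ
  exact CantorBendixson.iteratedDerivedSet_succ.trans
    (CantorBendixson.isClosed_iteratedDerivedSet isClosed_univ α).relDerivedSet_eq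

theorem mem_cbDeriv_of_isSuccLimit (hα : IsSuccLimit α) :
    x ∈ cbDeriv τ α ↔ ∀ β < α, x ∈ cbDeriv τ β := by
  have : cbDeriv τ α = ⋂ β : Set.Iio α, cbDeriv τ β :=
    @CantorBendixson.iteratedDerivedSet_limit X τ Set.univ α hα
  simp only [this, Set.mem_iInter, Subtype.forall, Set.mem_Iio]

theorem cbDeriv_antitone (τ : TopologicalSpace X) : Antitone (cbDeriv τ) :=
  @CantorBendixson.iteratedDerivedSet_antitone X τ Set.univ

theorem mem_cbDeriv_cbRank (x : X) : x ∈ cbDeriv τ (cbRank τ x) := by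
  have hlt : ∀ α < cbRank τ x, x ∈ cbDeriv τ (α + 1) := fun α hα =>
    of_not_not (notMem_of_lt_csInf' (s := {α | x ∉ cbDeriv τ (α + 1)}) hα)
  rcases Ordinal.zero_or_succ_or_isSuccLimit (cbRank τ x) with h0 | ⟨β, hβ⟩ | hl
  · rw [h0, cbDeriv_zero]
    trivial
  · exact hβ ▸ hlt β (hβ ▸ lt_succ β)
  · exact (mem_cbDeriv_of_isSuccLimit hl).2 fun β hβ =>
      cbDeriv_antitone τ (le_succ β) (hlt β hβ)

namespace IsScattered

theorem mono (h : IsScattered τ) (hσ : σ ≤ τ) : IsScattered σ := by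
  intro A hA
  obtain ⟨x, hx, U, hU, hUA⟩ := h A hA
  exact ⟨x, hx, U, hσ U hU, hUA⟩

-- If `W` isolates a point `z` of `insert x (U ∩ A)`, then `U ∩ W` witnesses `z ∉ d A`, so `z ≠ x`.
theorem derivOp_diff_derivOp (h : IsScattered τ) (A : Set X) :
    derivOp τ (A \ derivOp τ A) = derivOp τ A := by
  refine (derivOp_mono Set.sdiff_subset).antisymm fun x hx => mem_derivOp_iff.2 fun U hU hxU => ?_
  obtain ⟨z, hz, W, hW, hWz⟩ := h (insert x (U ∩ A)) (Set.insert_nonempty _ _)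
  have hzW : z ∈ W := (hWz.symm ▸ rfl : z ∈ W ∩ insert x (U ∩ A)).1
  have hzU : z ∈ U := by
    rcases hz with rfl | hz
    exacts [hxU, hz.1]
  have hzA : z ∉ derivOp τ A :=
    notMem_derivOp_iff.2 ⟨U ∩ W, τ.isOpen_inter U W hU hW, ⟨hzU, hzW⟩, fun y hy hyA =>
      (hWz ▸ ⟨hy.2, .inr ⟨hy.1, hyA⟩⟩ : y ∈ ({z} : Set X))⟩
  have hne : z ≠ x := fun e => hzA (e ▸ hx)
  exact ⟨z, hzU, ⟨(hz.resolve_left hne).2, hzA⟩, hne⟩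

theorem exists_notMem_cbDeriv_add_one (h : IsScattered τ) (x : X) :
    ∃ α : Ordinal.{u}, x ∉ cbDeriv τ (α + 1) := by
  obtain ⟨α, hα⟩ := @CantorBendixson.iteratedDerivedSet_mem_fixedPoints X τ Set.univ
  have hfix : derivOp τ (cbDeriv τ α) = cbDeriv τ α :=
    (cbDeriv_add_one α).symm.trans
      ((@CantorBendixson.iteratedDerivedSet_succ X τ Set.univ α).trans hα)
  have hempty : cbDeriv τ α = ∅ := by
    rw [← hfix, ← h.derivOp_diff_derivOp, hfix, Set.sdiff_self]
    exact Set.eq_empty_of_forall_notMem fun y hy => by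
      obtain ⟨z, -, hz, -⟩ := mem_derivOp_iff.1 hy Set.univ (@isOpen_univ X τ) trivial
      exact hz
  exact ⟨α, fun hx => (hempty ▸ cbDeriv_antitone τ (le_succ α) hx : x ∈ (∅ : Set X))⟩

theorem mem_cbDeriv_iff (h : IsScattered τ) : x ∈ cbDeriv τ α ↔ α ≤ cbRank τ x := by
  refine ⟨fun hx => ?_, fun hα => cbDeriv_antitone τ hα (mem_cbDeriv_cbRank x)⟩
  by_contra hα
  have hnot : x ∉ cbDeriv τ (cbRank τ x + 1) := csInf_mem (h.exists_notMem_cbDeriv_add_one x)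
  exact hnot (cbDeriv_antitone τ (add_one_le_of_lt (not_le.1 hα)) hx)

end IsScattered

/-- A characterisation by neighborhoods of the Cantor–Bendixson rank function of a scattered
topology: near `x` the values of `ρ` at other points are smaller than `ρ x`, and they are cofinal
in it. -/
structure IsRankFunction (τ : TopologicalSpace X) (ρ : X → Ordinal.{u}) : Prop where
  lower : ∀ x, ∃ U, IsOpen[τ] U ∧ x ∈ U ∧ ∀ y ∈ U, y ≠ x → ρ y < ρ x
  cofinal : ∀ x U, IsOpen[τ] U → x ∈ U → ∀ α < ρ x, ∃ y ∈ U, α ≤ ρ y ∧ ρ y < ρ x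

theorem IsScattered.isRankFunction_cbRank (h : IsScattered τ) : IsRankFunction τ (cbRank τ) := by
  have hlower (x : X) : ∃ U, IsOpen[τ] U ∧ x ∈ U ∧ ∀ y ∈ U, y ≠ x → cbRank τ y < cbRank τ x := by
    have hx : x ∉ derivOp τ (cbDeriv τ (cbRank τ x)) := by
      rw [← cbDeriv_add_one, h.mem_cbDeriv_iff, add_one_le_iff]
      exact lt_irrefl _
    obtain ⟨U, hU, hxU, hUx⟩ := notMem_derivOp_iff.1 hx
    exact ⟨U, hU, hxU, fun y hyU hne =>
      not_le.1 fun hle => hne (hUx y hyU (h.mem_cbDeriv_iff.2 hle))⟩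
  refine ⟨hlower, fun x U hU hxU α hα => ?_⟩
  obtain ⟨V, hV, hxV, hVx⟩ := hlower x
  have hx : x ∈ derivOp τ (cbDeriv τ α) := by
    rwa [← cbDeriv_add_one, h.mem_cbDeriv_iff, add_one_le_iff]
  obtain ⟨y, ⟨hyU, hyV⟩, hyα, hne⟩ :=
    mem_derivOp_iff.1 hx (U ∩ V) (τ.isOpen_inter U V hU hV) ⟨hxU, hxV⟩
  exact ⟨y, hyU, h.mem_cbDeriv_iff.1 hyα, hVx y hyV hne⟩

namespace IsRankFunction

theorem isOpen_lt (h : IsRankFunction τ ρ) (β : Ordinal.{u}) : IsOpen[τ] {y | ρ y < β} := by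
  let _ := τ
  refine isOpen_iff_forall_mem_open.2 fun x hx => ?_
  obtain ⟨U, hU, hxU, hlt⟩ := h.lower x
  refine ⟨U, fun y hyU => ?_, hU, hxU⟩
  rcases eq_or_ne y x with rfl | hne
  exacts [hx, (hlt y hyU hne).trans hx]

theorem exists_rank_eq (h : IsRankFunction τ ρ) (hU : IsOpen[τ] U) (hx : x ∈ U) (hα : α ≤ ρ x) :
    ∃ y ∈ U, ρ y = α := by
  obtain ⟨y, ⟨hyU, hαy⟩, hmin⟩ := (InvImage.wf ρ (wellFounded_lt (α := Ordinal.{u}))).has_min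
    {y | y ∈ U ∧ α ≤ ρ y} ⟨x, hx, hα⟩
  refine ⟨y, hyU, hαy.antisymm' (not_lt.1 fun hlt => ?_)⟩
  obtain ⟨z, hzU, hαz, hzy⟩ := h.cofinal y U hU hyU α hlt
  exact hmin z ⟨hzU, hαz⟩ hzy

theorem mem_derivOp_setOf_le_iff (h : IsRankFunction τ ρ) :
    x ∈ derivOp τ {y | α ≤ ρ y} ↔ α < ρ x := by
  rw [mem_derivOp_iff]
  constructor
  · intro hx
    obtain ⟨U, hU, hxU, hlt⟩ := h.lower x
    obtain ⟨y, hyU, hαy, hne⟩ := hx U hU hxU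
    exact hαy.trans_lt (hlt y hyU hne)
  · intro hα U hU hxU
    obtain ⟨y, hyU, hαy, hyx⟩ := h.cofinal x U hU hxU α hα
    exact ⟨y, hyU, hαy, ne_of_apply_ne ρ hyx.ne⟩

theorem cbDeriv_eq (h : IsRankFunction τ ρ) (α : Ordinal.{u}) : cbDeriv τ α = {x | α ≤ ρ x} := by
  ext x
  induction α using Ordinal.limitRecOn generalizing x with
  | zero => simp [cbDeriv_zero]
  | add_one α ih =>
    rw [cbDeriv_add_one, Set.ext ih, h.mem_derivOp_setOf_le_iff]
    exact add_one_le_iff.symm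
  | limit α hα ih =>
    rw [mem_cbDeriv_of_isSuccLimit hα, Set.mem_ofPred_eq, hα.le_iff_forall_le]
    exact forall₂_congr fun β hβ => ih β hβ x

theorem cbRank_eq (h : IsRankFunction τ ρ) (x : X) : cbRank τ x = ρ x := by
  have : {α | x ∉ cbDeriv τ (α + 1)} = Set.Ici (ρ x) := by
    ext α
    rw [Set.mem_ofPred_eq, h.cbDeriv_eq, Set.mem_Ici, Set.mem_ofPred_eq, add_one_le_iff, not_lt]
  rw [cbRank, this, csInf_Ici]

theorem isScattered (h : IsRankFunction τ ρ) : IsScattered τ := by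
  intro A hA
  obtain ⟨x, hxA, hmin⟩ := (InvImage.wf ρ (wellFounded_lt (α := Ordinal.{u}))).has_min A hA
  obtain ⟨U, hU, hxU, hlt⟩ := h.lower x
  refine ⟨x, hxA, U, hU, Set.eq_singleton_iff_unique_mem.2 ⟨⟨hxU, hxA⟩, fun y hy => ?_⟩⟩
  by_contra hne
  exact hmin y hy.2 (hlt y hy.1 hne)

end IsRankFunction

end Scattered

/-! ### ℓ-extensions and ℓ-maximal topologies -/

section LMaximal

open Order TopologicalSpace

variable {X : Type u} {τ σ : TopologicalSpace X} {ρ : X → Ordinal.{u}} {A U V : Set X} {x : X}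

namespace IsLExtension

theorem refl (τ : TopologicalSpace X) : IsLExtension τ τ :=
  ⟨le_rfl, fun _ => rfl, fun U hU _ hx _ => ⟨U, hU, hx, subset_rfl⟩⟩

theorem trans {ν : TopologicalSpace X} (h : IsLExtension τ σ) (h' : IsLExtension σ ν) :
    IsLExtension τ ν := by
  refine ⟨h'.le.trans h.le, fun x => (h'.rank_eq x).trans (h.rank_eq x), fun U hU x hx hl => ?_⟩
  obtain ⟨V, hV, hxV, hVU⟩ := h'.nonlimit U hU x hx (by rwa [h.rank_eq])
  obtain ⟨W, hW, hxW, hWV⟩ := h.nonlimit V hV x hxV hl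
  exact ⟨W, hW, hxW, hWV.trans hVU⟩

theorem isRankFunction (h : IsLExtension τ σ) (hρ : IsRankFunction τ ρ) : IsRankFunction σ ρ := by
  have hσ := (hρ.isScattered.mono h.le).isRankFunction_cbRank
  rwa [show cbRank σ = ρ from funext fun x => (h.rank_eq x).trans (hρ.cbRank_eq x)] at hσ

theorem of_isRankFunction (hρ : IsRankFunction τ ρ) (hle : σ ≤ τ)
    (hcofinal : ∀ x U, IsOpen[σ] U → x ∈ U → ∀ α < ρ x, ∃ y ∈ U, α ≤ ρ y ∧ ρ y < ρ x)
    (hnonlimit : ∀ U : Set X, IsOpen[σ] U → ∀ x ∈ U, ¬ IsSuccLimit (ρ x) →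
      ∃ V : Set X, IsOpen[τ] V ∧ x ∈ V ∧ V ⊆ U) : IsLExtension τ σ := by
  have hσ : IsRankFunction σ ρ := by
    refine ⟨fun x => ?_, hcofinal⟩
    obtain ⟨U, hU, hxU, hlt⟩ := hρ.lower x
    exact ⟨U, hle U hU, hxU, hlt⟩
  exact ⟨hle, fun x => (hσ.cbRank_eq x).trans (hρ.cbRank_eq x).symm,
    fun U hU x hx hl => hnonlimit U hU x hx (by rwa [hρ.cbRank_eq] at hl)⟩

end IsLExtension

theorem exists_isOpen_subset_of_isOpen_sInf_of_isChain {c : Set (TopologicalSpace X)}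
    (hc : IsChain (· ≤ ·) c) (hne : c.Nonempty) (hU : IsOpen[sInf c] U) (hx : x ∈ U) :
    ∃ σ ∈ c, ∃ V, IsOpen[σ] V ∧ x ∈ V ∧ V ⊆ U := by
  have hmem : U ∈ @nhds X (sInf c) x := @IsOpen.mem_nhds X (sInf c) x U hU hx
  have hdir : DirectedOn ((fun σ => @nhds X σ x) ⁻¹'o (· ≥ ·)) c := fun a ha b hb => by
    rcases hc.total ha hb with h | h
    exacts [⟨a, ha, le_rfl, nhds_mono h⟩, ⟨b, hb, nhds_mono h, le_rfl⟩]
  rw [nhds_sInf, Filter.mem_biInf_of_directed hdir hne] at hmem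
  obtain ⟨σ, hσ, hmem⟩ := hmem
  obtain ⟨V, hVU, hV, hxV⟩ := (@mem_nhds_iff X σ x U).1 hmem
  exact ⟨σ, hσ, V, hV, hxV, hVU⟩

theorem IsLExtension.sInf_of_isChain (hτ : IsScattered τ) {c : Set (TopologicalSpace X)}
    (hc : IsChain (· ≤ ·) c) (hne : c.Nonempty) (hext : ∀ σ ∈ c, IsLExtension τ σ) :
    IsLExtension τ (sInf c) := by
  have hρ := hτ.isRankFunction_cbRank
  have hle : sInf c ≤ τ := hne.elim fun σ hσ => (sInf_le hσ).trans (hext σ hσ).le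
  refine .of_isRankFunction hρ hle (fun x U hU hx α hα => ?_) fun U hU x hx hl => ?_
  · obtain ⟨σ, hσ, V, hV, hxV, hVU⟩ :=
      exists_isOpen_subset_of_isOpen_sInf_of_isChain hc hne hU hx
    obtain ⟨y, hyV, hy⟩ := ((hext σ hσ).isRankFunction hρ).cofinal x V hV hxV α hα
    exact ⟨y, hVU hyV, hy⟩
  · obtain ⟨σ, hσ, V, hV, hxV, hVU⟩ :=
      exists_isOpen_subset_of_isOpen_sInf_of_isChain hc hne hU hx
    obtain ⟨W, hW, hxW, hWV⟩ := (hext σ hσ).nonlimit V hV x hxV hl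
    exact ⟨W, hW, hxW, hWV.trans hVU⟩

theorem IsScattered.exists_isLMaximal (h : IsScattered τ) :
    ∃ σ, IsLExtension τ σ ∧ IsLMaximal σ := by
  have hbdd (c : Set (TopologicalSpace X)ᵒᵈ) (hcs : c ⊆ {σ | IsLExtension τ (OrderDual.ofDual σ)})
      (hc : IsChain (· ≤ ·) c) :
      ∃ ub ∈ {σ | IsLExtension τ (OrderDual.ofDual σ)}, ∀ σ ∈ c, σ ≤ ub := by
    rcases c.eq_empty_or_nonempty with rfl | hne
    · exact ⟨OrderDual.toDual τ, IsLExtension.refl τ, by simp⟩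
    · exact ⟨OrderDual.toDual (sInf (OrderDual.toDual ⁻¹' c)), .sInf_of_isChain h hc.symm hne hcs,
        fun σ hσ => sInf_le (a := OrderDual.ofDual σ) hσ⟩
  obtain ⟨σ, hσ, hmax⟩ := zorn_le₀ _ hbdd
  exact ⟨OrderDual.ofDual σ, hσ, fun σ' hσ' =>
    hσ'.le.antisymm (hmax (y := OrderDual.toDual σ') (hσ.trans hσ') hσ'.le)⟩

theorem exists_isOpen_of_isOpen_inf_generateFrom_singleton {s : Set X}
    (hU : IsOpen[τ ⊓ generateFrom {s}] U) (hx : x ∈ U) :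
    ∃ W, IsOpen[τ] W ∧ x ∈ W ∧ (x ∉ s → W ⊆ U) ∧ W ∩ s ⊆ U := by
  have hgen : τ ⊓ generateFrom {s} = generateFrom ({W | IsOpen[τ] W} ∪ {s}) := by
    rw [generateFrom_union, generateFrom_setOfPred_isOpen]
  rw [hgen] at hU
  induction hU with
  | basic t ht =>
    rcases ht with ht | rfl
    · exact ⟨t, ht, hx, fun _ => subset_rfl, Set.inter_subset_left⟩
    · exact ⟨Set.univ, τ.isOpen_univ, trivial, fun h => absurd hx h, Set.inter_subset_right⟩
  | univ => exact ⟨Set.univ, τ.isOpen_univ, trivial, fun _ => subset_rfl, Set.subset_univ _⟩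
  | inter t t' _ _ ih ih' =>
    obtain ⟨W, hW, hxW, hWt, hWs⟩ := ih hx.1
    obtain ⟨W', hW', hxW', hWt', hWs'⟩ := ih' hx.2
    exact ⟨W ∩ W', τ.isOpen_inter W W' hW hW', ⟨hxW, hxW'⟩,
      fun h => Set.inter_subset_inter (hWt h) (hWt' h),
      fun z hz => ⟨hWs ⟨hz.1.1, hz.2⟩, hWs' ⟨hz.1.2, hz.2⟩⟩⟩
  | sUnion S _ ih =>
    obtain ⟨t, ht, hxt⟩ := hx
    obtain ⟨W, hW, hxW, hWt, hWs⟩ := ih t ht hxt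
    exact ⟨W, hW, hxW, fun h => (hWt h).trans (Set.subset_sUnion_of_mem ht),
      hWs.trans (Set.subset_sUnion_of_mem ht)⟩

theorem IsRankFunction.isLExtension_inf_generateFrom_insert (hρ : IsRankFunction τ ρ)
    (hx : IsSuccLimit (ρ x)) (hV : IsOpen[τ] V) (hVx : ∀ y ∈ V, ρ y < ρ x)
    (hcofinal : ∀ U, IsOpen[τ] U → x ∈ U → ∀ α < ρ x, ∃ y ∈ U, y ∈ V ∧ α ≤ ρ y) :
    IsLExtension τ (τ ⊓ generateFrom {insert x V}) := by
  have hother (U : Set X) (hU : IsOpen[τ ⊓ generateFrom {insert x V}] U) (y : X) (hy : y ∈ U)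
      (hne : y ≠ x) : ∃ W, IsOpen[τ] W ∧ y ∈ W ∧ W ⊆ U := by
    obtain ⟨W, hW, hyW, hWU, hWV⟩ := exists_isOpen_of_isOpen_inf_generateFrom_singleton hU hy
    by_cases hyV : y ∈ V
    · exact ⟨W ∩ V, τ.isOpen_inter W V hW hV, ⟨hyW, hyV⟩, fun z hz => hWV ⟨hz.1, .inr hz.2⟩⟩
    · exact ⟨W, hW, hyW, hWU (by simp [hne, hyV])⟩
  refine .of_isRankFunction hρ inf_le_left (fun y U hU hy α hα => ?_) fun U hU y hy hl => ?_
  · rcases eq_or_ne y x with rfl | hne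
    · obtain ⟨W, hW, hyW, -, hWV⟩ := exists_isOpen_of_isOpen_inf_generateFrom_singleton hU hy
      obtain ⟨z, hzW, hzV, hαz⟩ := hcofinal W hW hyW α hα
      exact ⟨z, hWV ⟨hzW, .inr hzV⟩, hαz, hVx z hzV⟩
    · obtain ⟨W, hW, hyW, hWU⟩ := hother U hU y hy hne
      obtain ⟨z, hzW, hz⟩ := hρ.cofinal y W hW hyW α hα
      exact ⟨z, hWU hzW, hz⟩
  · exact hother U hU y hy fun e => hl (e ▸ hx)

namespace IsLMaximal

theorem isOpen_insert (hmax : IsLMaximal τ) (hρ : IsRankFunction τ ρ) (hx : IsSuccLimit (ρ x))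
    (hV : IsOpen[τ] V) (hVx : ∀ y ∈ V, ρ y < ρ x)
    (hcofinal : ∀ U, IsOpen[τ] U → x ∈ U → ∀ α < ρ x, ∃ y ∈ U, y ∈ V ∧ α ≤ ρ y) :
    IsOpen[τ] (insert x V) := by
  have hτ := hmax _ (hρ.isLExtension_inf_generateFrom_insert hx hV hVx hcofinal)
  exact inf_eq_left.1 hτ _ (isOpen_generateFrom_of_mem rfl)

-- By maximality the points of smaller rank away from `A` have bounded rank near a limit point `x`
-- of `A` of limit rank, since otherwise they would form, together with `x`, a neighborhood of `x`.
theorem exists_bounded_of_mem_derivOp (hmax : IsLMaximal τ) (hρ : IsRankFunction τ ρ)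
    (hl : IsSuccLimit (ρ x)) (hx : x ∈ derivOp τ A) :
    ∃ U, IsOpen[τ] U ∧ x ∈ U ∧ ∃ α < ρ x, ∀ y ∈ U, ρ y < ρ x → y ∈ @interior X τ Aᶜ → ρ y < α := by
  by_contra! hcofinal
  let V : Set X := {y | ρ y < ρ x} ∩ @interior X τ Aᶜ
  have hV : IsOpen[τ] V := τ.isOpen_inter _ _ (hρ.isOpen_lt _) (@isOpen_interior X τ Aᶜ)
  have hins : IsOpen[τ] (insert x V) :=
    hmax.isOpen_insert hρ hl hV (fun y hy => hy.1) fun U hU hxU α hα => by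
      obtain ⟨y, hyU, hyx, hyA, hαy⟩ := hcofinal U hU hxU α hα
      exact ⟨y, hyU, ⟨hyx, hyA⟩, hαy⟩
  obtain ⟨y, hy, hyA, hne⟩ := mem_derivOp_iff.1 hx _ hins (Set.mem_insert _ _)
  exact @interior_subset X τ Aᶜ y (hy.resolve_left hne).2 hyA

theorem exists_lt_of_mem_derivOp (hmax : IsLMaximal τ) (hρ : IsRankFunction τ ρ)
    (hx : x ∈ derivOp τ A) :
    ∃ U, IsOpen[τ] U ∧ x ∈ U ∧ ∃ α < ρ x, ∀ y ∈ U, α < ρ y → y ∈ derivOp τ A := by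
  obtain ⟨U₀, hU₀, hxU₀, hlt⟩ := hρ.lower x
  rcases Ordinal.zero_or_succ_or_isSuccLimit (ρ x) with h0 | ⟨β, hβ⟩ | hl
  · obtain ⟨y, hy, -, hne⟩ := mem_derivOp_iff.1 hx U₀ hU₀ hxU₀
    exact absurd (h0 ▸ hlt y hy hne) not_lt_zero
  · refine ⟨U₀, hU₀, hxU₀, β, hβ ▸ lt_succ β, fun y hy hβy => ?_⟩
    rcases eq_or_ne y x with rfl | hne
    · exact hx
    · exact absurd hβy (lt_succ_iff.1 (hβ ▸ hlt y hy hne)).not_gt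
  obtain ⟨U, hU, hxU, α, hα, hbound⟩ := hmax.exists_bounded_of_mem_derivOp hρ hl hx
  refine ⟨U ∩ U₀, τ.isOpen_inter U U₀ hU hU₀, ⟨hxU, hxU₀⟩, α, hα, fun y hy hαy => ?_⟩
  rcases eq_or_ne y x with rfl | hyx
  · exact hx
  by_contra hyA
  obtain ⟨W, hW, hyW, hWA⟩ := notMem_derivOp_iff.1 hyA
  obtain ⟨z, ⟨hzW, hzU⟩, hαz, hzy⟩ :=
    hρ.cofinal y (W ∩ U) (τ.isOpen_inter W U hW hU) ⟨hyW, hy.1⟩ α hαy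
  have hzA : z ∈ @interior X τ Aᶜ := by
    refine (@mem_interior X τ z Aᶜ).2 ⟨W ∩ {w | ρ w < ρ y}, fun w hw hwA => ?_,
      τ.isOpen_inter _ _ hW (hρ.isOpen_lt _), hzW, hzy⟩
    exact hw.2.ne (congrArg ρ (hWA w hw.1 hwA))
  exact (hbound z hzU (hzy.trans (hlt y hy.2 hyx)) hzA).not_ge hαz

end IsLMaximal

theorem plusTopology_le (τ : TopologicalSpace X) : plusTopology τ ≤ τ := fun _ hU =>
  isOpen_generateFrom_of_mem (.inl hU)

theorem isOpen_plusTopology_derivOp (τ : TopologicalSpace X) (A : Set X) :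
    IsOpen[plusTopology τ] (derivOp τ A) :=
  isOpen_generateFrom_of_mem (.inr ⟨A, rfl⟩)

theorem IsRankFunction.isOpen_plusTopology_gt (hρ : IsRankFunction τ ρ) (α : Ordinal.{u}) :
    IsOpen[plusTopology τ] {x | α < ρ x} := by
  have : {x | α < ρ x} = derivOp τ {y | α ≤ ρ y} :=
    Set.ext fun x => hρ.mem_derivOp_setOf_le_iff.symm
  exact this ▸ isOpen_plusTopology_derivOp τ _

theorem IsLMaximal.exists_of_isOpen_plusTopology (hmax : IsLMaximal τ) (hρ : IsRankFunction τ ρ)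
    (hV : IsOpen[plusTopology τ] V) (hx : x ∈ V) (h0 : ρ x ≠ 0) :
    ∃ U, IsOpen[τ] U ∧ x ∈ U ∧ ∃ δ < ρ x, ∀ y ∈ U, δ < ρ y → y ∈ V := by
  induction hV with
  | basic s hs =>
    rcases hs with hs | ⟨A, rfl⟩
    · exact ⟨s, hs, hx, 0, pos_iff_ne_zero.2 h0, fun y hy _ => hy⟩
    · exact hmax.exists_lt_of_mem_derivOp hρ hx
  | univ => exact ⟨Set.univ, τ.isOpen_univ, trivial, 0, pos_iff_ne_zero.2 h0, fun y hy _ => hy⟩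
  | inter s t _ _ ihs iht =>
    obtain ⟨U, hU, hxU, δ, hδ, h⟩ := ihs hx.1
    obtain ⟨U', hU', hxU', δ', hδ', h'⟩ := iht hx.2
    exact ⟨U ∩ U', τ.isOpen_inter U U' hU hU', ⟨hxU, hxU'⟩, max δ δ', max_lt hδ hδ',
      fun y hy hy' => ⟨h y hy.1 ((le_max_left _ _).trans_lt hy'),
        h' y hy.2 ((le_max_right _ _).trans_lt hy')⟩⟩
  | sUnion S _ ih =>
    obtain ⟨s, hs, hxs⟩ := hx
    obtain ⟨U, hU, hxU, δ, hδ, h⟩ := ih s hs hxs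
    exact ⟨U, hU, hxU, δ, hδ, fun y hy hy' => ⟨s, hs, h y hy hy'⟩⟩

end LMaximal

/-! ### Lme-spaces -/

section LmeSpace

open Order Ordinal

variable {X : Type u} {τ τb : TopologicalSpace X} {ρ r : X → Ordinal.{u}}

/-- `r` is a d-map (continuous, open and pointwise discrete) from `τ` to the ordinals with their
order topology. Openness is only required on left neighborhoods, so that the image of `r` may be
any initial segment. -/
structure IsOrdinalDMap (τ : TopologicalSpace X) (r : X → Ordinal.{u}) : Prop where
  isOpen_lt : ∀ β, IsOpen[τ] {x | r x < β}
  isOpen_gt : ∀ β, IsOpen[τ] {x | β < r x}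
  discrete : ∀ x, ∃ U, IsOpen[τ] U ∧ x ∈ U ∧ ∀ y ∈ U, r y = r x → y = x
  open_map : ∀ x U, IsOpen[τ] U → x ∈ U → r x ≠ 0 →
    ∃ δ < r x, ∀ ξ, δ < ξ → ξ ≤ r x → ∃ y ∈ U, r y = ξ

namespace IsOrdinalDMap

theorem isOpen_Ioc (h : IsOrdinalDMap τ r) (γ β : Ordinal.{u}) :
    IsOpen[τ] {x | γ < r x ∧ r x ≤ β} := by
  simp only [← lt_succ_iff]
  exact τ.isOpen_inter _ _ (h.isOpen_gt γ) (h.isOpen_lt (succ β))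

theorem isRankFunction (h : IsOrdinalDMap τ r) : IsRankFunction τ fun x => endLog (r x) := by
  refine ⟨fun x => ?_, fun x U hU hxU α hα => ?_⟩
  · obtain ⟨U, hU, hxU, hdisc⟩ := h.discrete x
    rcases eq_or_ne (r x) 0 with h0 | h0
    · exact ⟨U ∩ {y | r y < 1}, τ.isOpen_inter _ _ hU (h.isOpen_lt 1), ⟨hxU, by simp [h0]⟩,
        fun y hy hne => absurd (hdisc y hy.1 (h0 ▸ lt_one_iff.1 hy.2)) hne⟩
    · obtain ⟨δ, hδ, hlt⟩ := exists_forall_endLog_lt h0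
      exact ⟨U ∩ {y | δ < r y ∧ r y ≤ r x}, τ.isOpen_inter _ _ hU (h.isOpen_Ioc δ (r x)),
        ⟨hxU, hδ, le_rfl⟩, fun y hy hne =>
          hlt (r y) hy.2.1 (hy.2.2.lt_of_ne fun e => hne (hdisc y hy.1 e))⟩
  · have h0 : r x ≠ 0 := fun e => by simp [e, endLog_zero] at hα
    obtain ⟨δ, hδ, hopen⟩ := h.open_map x U hU hxU h0
    obtain ⟨ξ, hδξ, hξ, rfl⟩ := exists_endLog_eq hδ hα
    obtain ⟨y, hyU, rfl⟩ := hopen ξ hδξ hξ.le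
    exact ⟨y, hyU, le_rfl, hα⟩

end IsOrdinalDMap

theorem IsLMaximal.isOrdinalDMap_plusTopology (hmax : IsLMaximal τ) (hρ : IsRankFunction τ ρ) :
    IsOrdinalDMap (plusTopology τ) ρ := by
  refine ⟨fun β => plusTopology_le τ _ (hρ.isOpen_lt β), hρ.isOpen_plusTopology_gt, fun x => ?_,
    fun x V hV hx h0 => ?_⟩
  · obtain ⟨U, hU, hxU, hlt⟩ := hρ.lower x
    exact ⟨U, plusTopology_le τ _ hU, hxU,
      fun y hyU e => of_not_not fun hne => (hlt y hyU hne).ne e⟩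
  · obtain ⟨U, hU, hxU, δ, hδ, hV'⟩ := hmax.exists_of_isOpen_plusTopology hρ hV hx h0
    refine ⟨δ, hδ, fun ξ hδξ hξ => ?_⟩
    obtain ⟨y, hyU, rfl⟩ := hρ.exists_rank_eq hU hxU hξ
    exact ⟨y, hV' y hyU hδξ, rfl⟩

theorem isOrdinalDMap_toOrd (o : Ordinal.{u}) :
    IsOrdinalDMap (Preorder.topology o.ToType) fun x => (ToType.toOrd x : Ordinal) := by
  let _ := Preorder.topology o.ToType
  have _ : OrderTopology o.ToType := ⟨rfl⟩
  have hcont : Continuous fun x : o.ToType => (ToType.toOrd x : Ordinal) :=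
    continuous_subtype_val.comp (ToType.mk (o := o)).symm.continuous
  have hmono : StrictMono fun x : o.ToType => (ToType.toOrd x : Ordinal) :=
    (Subtype.strictMono_coe _).comp (ToType.mk (o := o)).symm.strictMono
  have hsurj (x : o.ToType) (β : Ordinal) (hβ : β ≤ (ToType.toOrd x : Ordinal)) :
      ∃ y : o.ToType, (ToType.toOrd y : Ordinal) = β :=
    ⟨ToType.mk ⟨β, hβ.trans_lt (ToType.toOrd x).2⟩, by simp⟩
  refine ⟨fun β => isOpen_Iio.preimage hcont, fun β => isOpen_Ioi.preimage hcont,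
    fun x => ⟨Set.univ, isOpen_univ, trivial, fun y _ h => hmono.injective h⟩,
    fun x U hU hxU h0 => ?_⟩
  obtain ⟨z, hz⟩ := hsurj x 0 zero_le
  have hzx : z < x := hmono.lt_iff_lt.1 (hz ▸ pos_iff_ne_zero.2 h0)
  obtain ⟨l, hl, hlU⟩ := exists_Ioc_subset_of_mem_nhds (hU.mem_nhds hxU) ⟨z, hzx⟩
  refine ⟨(ToType.toOrd l : Ordinal), hmono hl, fun ξ hlξ hξ => ?_⟩
  obtain ⟨y, rfl⟩ := hsurj x ξ hξ
  exact ⟨y, hlU ⟨hmono.lt_iff_lt.1 hlξ, hmono.le_iff_le.1 hξ⟩, rfl⟩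

/-- The data carried by an lme-space: `τ n` is its `n`-th topology, `b n` the topology that `τ n`
extends, `r n` a d-map from `b n` to the ordinals, and `r (n + 1)` the rank function of `b n`. -/
structure RankTower (b τ : ℕ → TopologicalSpace X) (r : ℕ → X → Ordinal.{u}) : Prop where
  dmap : ∀ n, IsOrdinalDMap (b n) (r n)
  ext : ∀ n, IsLExtension (b n) (τ n)
  succ_le : ∀ n, b (n + 1) ≤ τ n
  succ_eq : ∀ n x, r (n + 1) x = endLog (r n x)

namespace RankTower

variable {b τ : ℕ → TopologicalSpace X} {r : ℕ → X → Ordinal.{u}} {m n : ℕ}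

theorem isRankFunction_base (h : RankTower b τ r) (n : ℕ) : IsRankFunction (b n) (r (n + 1)) := by
  rw [show r (n + 1) = fun x => endLog (r n x) from funext (h.succ_eq n)]
  exact (h.dmap n).isRankFunction

theorem isRankFunction (h : RankTower b τ r) (n : ℕ) : IsRankFunction (τ n) (r (n + 1)) :=
  (h.ext n).isRankFunction (h.isRankFunction_base n)

theorem exists_isOpen_base (h : RankTower b τ r) {U : Set X} (hU : IsOpen[τ n] U) {x : X}
    (hx : x ∈ U) (hl : ¬ IsSuccLimit (r (n + 1) x)) : ∃ V, IsOpen[b n] V ∧ x ∈ V ∧ V ⊆ U :=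
  (h.ext n).nonlimit U hU x hx (by rwa [(h.isRankFunction_base n).cbRank_eq])

theorem antitone (h : RankTower b τ r) : Antitone τ :=
  antitone_nat_of_succ_le fun n => (h.ext (n + 1)).le.trans (h.succ_le n)

theorem le_base (h : RankTower b τ r) (hnm : n ≤ m) : τ m ≤ b n :=
  (h.antitone hnm).trans (h.ext n).le

end RankTower

/-- The topologies of which the members of an lme-space based on `τb` are ℓ-extensions. -/
abbrev lmeBase (τb : TopologicalSpace X) (τ : ℕ → TopologicalSpace X) : ℕ → TopologicalSpace X
  | 0 => τb
  | n + 1 => plusTopology (τ n)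

namespace IsLmeSpace

variable {τ : ℕ → TopologicalSpace X}

theorem isLExtension_lmeBase (h : IsLmeSpace τb τ) : ∀ n, IsLExtension (lmeBase τb τ n) (τ n)
  | 0 => h.zero_ext
  | n + 1 => h.succ_ext n

theorem isLMaximal (h : IsLmeSpace τb τ) : ∀ n, IsLMaximal (τ n)
  | 0 => h.zero_max
  | n + 1 => h.succ_max n

theorem rankTower (h : IsLmeSpace τb τ) (hr : IsOrdinalDMap τb r) :
    RankTower (lmeBase τb τ) τ fun n x => endLog^[n] (r x) := by
  have hsucc (n : ℕ) (x : X) : endLog^[n + 1] (r x) = endLog (endLog^[n] (r x)) :=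
    Function.iterate_succ_apply' endLog n (r x)
  have hdmap (n : ℕ) : IsOrdinalDMap (lmeBase τb τ n) fun x => endLog^[n] (r x) := by
    induction n with
    | zero => exact hr
    | succ n ih =>
      simp only [hsucc]
      exact (h.isLMaximal n).isOrdinalDMap_plusTopology
        ((h.isLExtension_lmeBase n).isRankFunction ih.isRankFunction)
  exact ⟨hdmap, h.isLExtension_lmeBase, fun n => plusTopology_le (τ n), hsucc⟩

end IsLmeSpace

theorem IsScattered.exists_isLmeSpace (h : IsScattered τb) : ∃ τ, IsLmeSpace τb τ := by
  choose F hF hmax using fun σ : {σ : TopologicalSpace X // IsScattered σ} =>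
    σ.2.exists_isLMaximal
  have hplus (σ : {σ : TopologicalSpace X // IsScattered σ}) : IsScattered (plusTopology (F σ)) :=
    σ.2.mono ((plusTopology_le _).trans (hF σ).le)
  let s : ℕ → {σ : TopologicalSpace X // IsScattered σ} := fun n =>
    Nat.rec ⟨τb, h⟩ (fun _ σ => ⟨plusTopology (F σ), hplus σ⟩) n
  exact ⟨fun n => F (s n), h, hF (s 0), hmax (s 0), fun n => hF (s (n + 1)),
    fun n => hmax (s (n + 1))⟩

end LmeSpace

/-! ### Maximal consistent theories over GLP -/

section CanonicalWorlds

open ModalFormula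

theorem GLPProvable.box_imp_box {φ ψ : ModalFormula} (h : GLPProvable (imp φ ψ)) (n : ℕ) :
    GLPProvable (imp (box n φ) (box n ψ)) :=
  .mp (.nec n h) (.distr n φ ψ)

/-- A theory over GLP: a set of formulas that contains the theorems of GLP and is closed under
modus ponens, but not necessarily under necessitation. -/
structure IsGLPTheory (T : Set ModalFormula) : Prop where
  thm {φ : ModalFormula} : GLPProvable φ → φ ∈ T
  mp {φ ψ : ModalFormula} : φ ∈ T → imp φ ψ ∈ T → ψ ∈ T

/-- A maximal consistent theory over GLP. -/
structure IsGLPMaximal (w : Set ModalFormula) : Prop extends IsGLPTheory w where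
  bot_notMem : bot ∉ w
  total (φ : ModalFormula) : φ ∈ w ∨ neg φ ∈ w

/-- The points of the canonical model of GLP. -/
abbrev GLPWorld : Type := {w : Set ModalFormula // IsGLPMaximal w}

namespace IsGLPTheory

variable {T : Set ModalFormula} {m n : ℕ} {φ ψ : ModalFormula}

theorem of_provable_imp (hT : IsGLPTheory T) (hφ : φ ∈ T) (h : GLPProvable (imp φ ψ)) : ψ ∈ T :=
  hT.mp hφ (hT.thm h)

theorem of_taut (hT : IsGLPTheory T) (hφ : IsTautology φ) : φ ∈ T :=
  hT.thm (.taut hφ)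

theorem imp_of_mem (hT : IsGLPTheory T) (ψ : ModalFormula) (hφ : φ ∈ T) : imp ψ φ ∈ T :=
  hT.mp hφ (hT.of_taut fun e _ hi => by simp only [hi]; tauto)

theorem adjoin (hT : IsGLPTheory T) (ψ : ModalFormula) : IsGLPTheory {χ | imp ψ χ ∈ T} where
  thm hφ := hT.imp_of_mem ψ (hT.thm hφ)
  mp h₁ h₂ := hT.mp h₁ (hT.mp h₂ (hT.of_taut fun e _ hi => by simp only [hi]; tauto))

theorem setOf_box_mem (hT : IsGLPTheory T) (n : ℕ) : IsGLPTheory {χ | box n χ ∈ T} where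
  thm hφ := hT.thm (.nec n hφ)
  mp h₁ h₂ := hT.mp h₁ (hT.of_provable_imp h₂ (.distr n _ _))

theorem sUnion_of_isChain {c : Set (Set ModalFormula)} (hT : ∀ T ∈ c, IsGLPTheory T)
    (hc : IsChain (· ⊆ ·) c) (hne : c.Nonempty) : IsGLPTheory (⋃₀ c) where
  thm hφ := hne.imp fun T hTc => ⟨hTc, (hT T hTc).thm hφ⟩
  mp := by
    rintro φ ψ ⟨S, hS, hφ⟩ ⟨T, hTc, hi⟩
    rcases hc.total hS hTc with hST | hTS
    · exact ⟨T, hTc, (hT T hTc).mp (hST hφ) hi⟩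
    · exact ⟨S, hS, (hT S hS).mp hφ (hTS hi)⟩

theorem isGLPMaximal_of_maximal (h : Maximal (fun S => IsGLPTheory S ∧ φ ∉ S) T) :
    IsGLPMaximal T := by
  have hT : IsGLPTheory T := h.prop.1
  have imp_mem_of_notMem {ψ : ModalFormula} (hψ : ψ ∉ T) : imp ψ φ ∈ T := by
    by_contra hn
    have hle : {χ | imp ψ χ ∈ T} ⊆ T :=
      h.le_of_ge ⟨hT.adjoin ψ, hn⟩ fun χ hχ => hT.imp_of_mem ψ hχ
    exact hψ (hle (hT.of_taut fun e _ hi => by simp only [hi]; tauto))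
  refine ⟨hT, fun hb => h.prop.2 (hT.mp hb (hT.of_taut fun e _ hi => ?_)), fun ψ => ?_⟩
  · simp only [hi]
    tauto
  · by_contra! hn
    have hneg := hT.mp (imp_mem_of_notMem hn.2) (ψ := imp (imp ψ φ) φ)
      (hT.of_taut fun e _ hi => by simp only [hi, neg]; tauto)
    exact h.prop.2 (hT.mp (imp_mem_of_notMem hn.1) hneg)

theorem exists_world (hT : IsGLPTheory T) (hφ : φ ∉ T) : ∃ w : GLPWorld, T ⊆ w.1 ∧ φ ∉ w.1 := by
  obtain ⟨w, hTw, hw⟩ := zorn_subset_nonempty {S | IsGLPTheory S ∧ φ ∉ S}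
    (fun c hcs hc hne =>
      ⟨⋃₀ c, ⟨sUnion_of_isChain (fun S hS => (hcs hS).1) hc hne,
        fun ⟨S, hS, hφS⟩ => (hcs hS).2 hφS⟩, fun S hS => Set.subset_sUnion_of_mem hS⟩) T ⟨hT, hφ⟩
  exact ⟨⟨w, isGLPMaximal_of_maximal hw⟩, hTw, hw.prop.2⟩

theorem box_of_le (hT : IsGLPTheory T) (hmn : m ≤ n) (hφ : box m φ ∈ T) : box n φ ∈ T := by
  rcases hmn.lt_or_eq with hlt | rfl
  · exact hT.of_provable_imp hφ (.mono hlt φ)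
  · exact hφ

theorem box_box (hT : IsGLPTheory T) (hφ : box n φ ∈ T) : box n (box n φ) ∈ T := by
  -- The Löb law applied to the conjunction of `φ` and `[n]φ`.
  let χ : ModalFormula := neg (imp φ (neg (box n φ)))
  have hχφ : GLPProvable (imp χ φ) := .taut fun e _ hi => by
    simp only [χ, neg, hi]
    tauto
  have hχbox : GLPProvable (imp χ (box n φ)) := .taut fun e _ hi => by
    simp only [χ, neg, hi]
    tauto
  have hstep : GLPProvable (imp φ (imp (box n χ) χ)) :=
    .mp (hχφ.box_imp_box n) (.taut fun e _ hi => by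
      simp only [χ, neg, hi]
      tauto)
  have hχ : box n χ ∈ T :=
    hT.of_provable_imp (hT.of_provable_imp hφ (hstep.box_imp_box n)) (.loeb n χ)
  exact hT.of_provable_imp hχ (hχbox.box_imp_box n)

theorem box_neg_box (hT : IsGLPTheory T) (hmn : m < n) (hφ : neg (box m φ) ∈ T) :
    box n (neg (box m φ)) ∈ T := by
  have box_of_box_neg_neg : GLPProvable (imp (box m (neg (neg φ))) (box m φ)) :=
    .box_imp_box (.taut fun e _ hi => by simp only [neg, hi]; tauto) m
  have box_neg_neg_of_box : GLPProvable (imp (box m φ) (box m (neg (neg φ)))) :=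
    .box_imp_box (.taut fun e _ hi => by simp only [neg, hi]; tauto) m
  have neg_box_imp_dia : GLPProvable (imp (neg (box m φ)) (dia m (neg φ))) :=
    .mp box_of_box_neg_neg (.taut fun e _ hi => by simp only [neg, dia, hi]; tauto)
  have dia_imp_neg_box : GLPProvable (imp (dia m (neg φ)) (neg (box m φ))) :=
    .mp box_neg_neg_of_box (.taut fun e _ hi => by simp only [neg, dia, hi]; tauto)
  have hdia := hT.of_provable_imp (hT.of_provable_imp hφ neg_box_imp_dia) (.negIntro hmn (neg φ))
  exact hT.of_provable_imp hdia (dia_imp_neg_box.box_imp_box n)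

end IsGLPTheory

theorem exists_world_of_not_provable {φ : ModalFormula} (hφ : ¬ GLPProvable φ) :
    ∃ w : GLPWorld, φ ∉ w.1 :=
  have hGLP : IsGLPTheory GLP := ⟨id, .mp⟩
  (hGLP.exists_world hφ).imp fun _ h => h.2

namespace IsGLPMaximal

variable {w : Set ModalFormula} {φ ψ : ModalFormula}

theorem neg_mem_iff (h : IsGLPMaximal w) : neg φ ∈ w ↔ φ ∉ w :=
  ⟨fun hn hφ => h.bot_notMem (h.mp hφ hn), (h.total φ).resolve_left⟩

theorem imp_mem_iff (h : IsGLPMaximal w) : imp φ ψ ∈ w ↔ (φ ∈ w → ψ ∈ w) := by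
  refine ⟨fun hi hφ => h.mp hφ hi, fun hi => ?_⟩
  by_cases hφ : φ ∈ w
  · exact h.imp_of_mem φ (hi hφ)
  · exact h.mp (h.neg_mem_iff.2 hφ) (h.of_taut fun e _ hi => by simp only [hi, neg]; tauto)

end IsGLPMaximal

/-- The accessibility relation of the modality `n` between the points of the canonical model. For
`m < n` the points related by it agree on the formulas `[m]φ`. -/
structure CanonicalRel (n : ℕ) (w v : GLPWorld) : Prop where
  mem {φ : ModalFormula} : box n φ ∈ w.1 → φ ∈ v.1
  box_mem {φ : ModalFormula} : box n φ ∈ w.1 → box n φ ∈ v.1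
  box_mem_iff {m : ℕ} : m < n → ∀ {φ : ModalFormula}, box m φ ∈ w.1 ↔ box m φ ∈ v.1

namespace CanonicalRel

variable {n : ℕ} {u v w : GLPWorld}

theorem trans (hwv : CanonicalRel n w v) (hvu : CanonicalRel n v u) : CanonicalRel n w u where
  mem hφ := hvu.mem (hwv.box_mem hφ)
  box_mem hφ := hvu.box_mem (hwv.box_mem hφ)
  box_mem_iff hm := (hwv.box_mem_iff hm).trans (hvu.box_mem_iff hm)

theorem of_succ (h : CanonicalRel (n + 1) w v) : CanonicalRel n w v where
  mem hφ := h.mem (w.2.box_of_le n.le_succ hφ)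
  box_mem := (h.box_mem_iff n.lt_succ_self).1
  box_mem_iff hm := h.box_mem_iff (hm.trans n.lt_succ_self)

end CanonicalRel

theorem exists_canonicalRel {n : ℕ} {w : GLPWorld} {ψ : ModalFormula} (hψ : box n ψ ∉ w.1) :
    ∃ v, CanonicalRel n w v ∧ box n ψ ∈ v.1 ∧ ψ ∉ v.1 := by
  have hw : IsGLPTheory w.1 := w.2.toIsGLPTheory
  -- By the Löb law, the formulas boxed in `w` together with `[n]ψ` do not entail `ψ`.
  obtain ⟨v, hTv, hψv⟩ := ((hw.setOf_box_mem n).adjoin (box n ψ)).exists_world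
    (φ := ψ) fun h => hψ (hw.of_provable_imp h (.loeb n ψ))
  have hv {χ : ModalFormula} (hχ : box n χ ∈ w.1) : χ ∈ v.1 :=
    hTv ((hw.setOf_box_mem n).imp_of_mem _ hχ)
  refine ⟨v, ⟨hv, fun hφ => hv (hw.box_box hφ), fun hm φ =>
    ⟨fun hφ => hv (hw.box_of_le hm.le (hw.box_box hφ)), fun hφ => ?_⟩⟩, hTv ?_, hψv⟩
  · by_contra hn
    exact v.2.neg_mem_iff.1 (hv (hw.box_neg_box hm (w.2.neg_mem_iff.2 hn))) hφ
  · exact (hw.setOf_box_mem n).of_taut fun e _ hi => by simp only [hi]; tauto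

end CanonicalWorlds

/-! ### Labellings of ordinals by canonical worlds -/

section Labelling

open Order Ordinal ModalFormula

theorem ordinal_sub_pos {α β : Ordinal.{u}} (h : α < β) : 0 < β - α :=
  lt_sub.2 (by rwa [add_zero])

variable {X : Type u}

/-- At the point `x`, the labelling `F` agrees on the formulas `[m]ψ`, `ψ ∈ Ψ`, with the
semantics of derived sets. -/
def LabelsAt (τ : TopologicalSpace X) (Ψ : Finset ModalFormula) (m : ℕ) (F : X → GLPWorld)
    (x : X) : Prop :=
  ∀ ψ ∈ Ψ, box m ψ ∈ (F x).1 ↔ x ∉ derivOp τ {y | ψ ∉ (F y).1}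

theorem LabelsAt.congr {τ : TopologicalSpace X} {Ψ : Finset ModalFormula} {m : ℕ} {S : Set X}
    {F F' : X → GLPWorld} {x : X} (h : LabelsAt τ Ψ m F' x) (hS : IsOpen[τ] S) (hx : x ∈ S)
    (hF : ∀ y ∈ S, F y = F' y) : LabelsAt τ Ψ m F x := by
  intro ψ hψ
  rw [hF x hx, h ψ hψ, not_iff_not]
  exact mem_derivOp_congr hS hx fun y hy => by simp only [Set.mem_ofPred_eq, hF y hy]

variable (τ : ℕ → TopologicalSpace X) (r : ℕ → X → Ordinal.{u}) (Ψ : Finset ModalFormula)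
  (N n : ℕ) (w : GLPWorld) (l : Ordinal.{u}) (f : Ordinal.{u} → GLPWorld)

/-- The labelling `f` of the interval `(0, l]`, transported by `r n` from any of its translates
`(γ, γ + l]`, is correct for the modalities `m ∈ [n, N)`. -/
def GoodLabelling : Prop :=
  ∀ (γ : Ordinal.{u}) (x : X), γ < r n x → r n x ≤ γ + l → ∀ m, n ≤ m → m < N →
    LabelsAt (τ m) Ψ m (fun y => f (r n y - γ)) x

/-- The world `w` labels the endpoint of a good labelling `f` of the interval `(0, l]`, `l < ε₀`,
by successors of `w`. -/
structure IsRealization : Prop where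
  pos : 0 < l
  lt_epsilon_zero : l < ε₀
  good : GoodLabelling τ r Ψ N n l f
  endpoint : f l = w
  rel : ∀ ξ, 0 < ξ → ξ < l → CanonicalRel n w (f ξ)

/-- The world `w` has a realization. -/
def Realizable : Prop :=
  ∃ (l : Ordinal.{u}) (f : Ordinal.{u} → GLPWorld), IsRealization τ r Ψ N n w l f

variable {τ r Ψ N n w l f} {b : ℕ → TopologicalSpace X} {k : Ordinal.{u}}
  {g h : Ordinal.{u} → GLPWorld}

open Classical in
theorem GoodLabelling.concat (ht : RankTower b τ r) (hf : GoodLabelling τ r Ψ N n k f)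
    (hg : GoodLabelling τ r Ψ N n l g) :
    GoodLabelling τ r Ψ N n (k + l) fun ξ => if ξ ≤ k then f ξ else g (ξ - k) := by
  intro γ x hγx hx m hnm hmN
  rcases le_or_gt (r n x) (γ + k) with hxk | hkx
  · refine (hf γ x hγx hxk m hnm hmN).congr (ht.le_base hnm _ ((ht.dmap n).isOpen_Ioc γ (γ + k)))
      ⟨hγx, hxk⟩ fun y hy => if_pos (sub_le.2 hy.2)
  · refine (hg (γ + k) x hkx (by rwa [add_assoc]) m hnm hmN).congr
      (ht.le_base hnm _ ((ht.dmap n).isOpen_gt (γ + k))) hkx fun y hy => ?_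
    simp only [if_neg fun h => (sub_le.1 h).not_gt hy, sub_sub]

theorem realizable_of_forall_box_mem (ht : RankTower b τ r)
    (hw : ∀ m, n ≤ m → m < N → ∀ ψ ∈ Ψ, box m ψ ∈ w.1) : Realizable τ r Ψ N n w := by
  refine ⟨1, fun _ => w, zero_lt_one, ?_, fun γ x hγx hx m hnm hmN ψ hψ => ?_, rfl,
    fun ξ h0 h1 => absurd (Order.lt_one_iff.1 h1) h0.ne'⟩
  · simpa using omega0_opow_lt_epsilon_zero (epsilon_pos 0)
  · refine iff_of_true (hw m hnm hmN ψ hψ) (notMem_derivOp_iff.2 ?_)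
    obtain ⟨U, hU, hxU, hdisc⟩ := (ht.dmap n).discrete x
    refine ⟨_, ht.le_base hnm _ ((b n).isOpen_inter _ _ hU ((ht.dmap n).isOpen_Ioc γ (γ + 1))),
      ⟨hxU, hγx, hx⟩, fun y hy _ => hdisc y hy.1 ?_⟩
    have eq_add_one {ξ : Ordinal.{u}} (h₁ : γ < ξ) (h₂ : ξ ≤ γ + 1) : ξ = γ + 1 :=
      h₂.antisymm (add_one_le_iff.2 h₁)
    rw [eq_add_one hγx hx, eq_add_one hy.2.1 hy.2.2]

open Classical in
theorem exists_goodLabelling_of_forall_realizable (ht : RankTower b τ r)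
    (B : Finset ModalFormula)
    (hB : ∀ ψ ∈ B, ∃ v, CanonicalRel n w v ∧ ψ ∉ v.1 ∧ Realizable τ r Ψ N n v) :
    ∃ (k : Ordinal.{u}) (h : Ordinal.{u} → GLPWorld), k < ε₀ ∧ GoodLabelling τ r Ψ N n k h ∧
      (∀ ξ, 0 < ξ → ξ ≤ k → CanonicalRel n w (h ξ)) ∧
      ∀ ψ ∈ B, ∃ ξ, 0 < ξ ∧ ξ ≤ k ∧ ψ ∉ (h ξ).1 := by
  induction B using Finset.induction_on with
  | empty =>
    exact ⟨0, fun _ => w, epsilon_pos 0, fun γ x h0 h1 => absurd h0 (add_zero γ ▸ h1).not_gt,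
      fun ξ h0 h1 => absurd h0 h1.not_gt, by simp⟩
  | insert ψ B _ ih =>
    obtain ⟨k, h, hk, hgood, hrel, hrefute⟩ := ih fun χ hχ => hB χ (Finset.mem_insert_of_mem hχ)
    obtain ⟨v, hwv, hψv, l, f, hf⟩ := hB ψ (Finset.mem_insert_self _ _)
    refine ⟨k + l, _, add_lt_epsilon_zero hk hf.lt_epsilon_zero, hgood.concat ht hf.good,
      fun ξ h0 h1 => ?_, fun χ hχ => ?_⟩
    · by_cases hξ : ξ ≤ k
      · simpa only [if_pos hξ] using hrel ξ h0 hξ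
      · rw [if_neg hξ]
        have hpos : 0 < ξ - k := ordinal_sub_pos (not_le.1 hξ)
        rcases (sub_le.2 h1).lt_or_eq with hlt | heq
        · exact hwv.trans (hf.rel _ hpos hlt)
        · rwa [heq, hf.endpoint]
    · rcases Finset.mem_insert.1 hχ with rfl | hχ
      · refine ⟨k + l, hf.pos.trans_le le_add_self, le_rfl, ?_⟩
        rwa [if_neg (lt_add_of_pos_right k hf.pos).not_ge, add_sub_cancel, hf.endpoint]
      · obtain ⟨ξ, h0, h1, hξ⟩ := hrefute χ hχ
        exact ⟨ξ, h0, h1.trans le_self_add, by rwa [if_pos h1]⟩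

open Classical in
/-- Blocks of length `k` labelled by `h`, accumulating at the points with end-logarithm above
`log ω k`, which are labelled by `g` according to their end-logarithm. -/
noncomputable def blockLabelling (k : Ordinal.{u}) (g h : Ordinal.{u} → GLPWorld)
    (ξ : Ordinal.{u}) : GLPWorld :=
  if log ω k < endLog ξ then g (endLog ξ - log ω k) else h (blockPos k ξ)

theorem blockLabelling_of_lt {ξ : Ordinal.{u}} (hξ : log ω k < endLog ξ) :
    blockLabelling k g h ξ = g (endLog ξ - log ω k) :=
  if_pos hξ

theorem blockLabelling_mul_add {q η : Ordinal.{u}} (h0 : 0 < η) (h1 : η ≤ k) :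
    blockLabelling k g h (k * q + η) = h η := by
  rw [blockLabelling, if_neg (endLog_mul_add_le h0 h1).not_gt, blockPos_mul_add h0 h1]

theorem blockLabelling_omega0_opow (hl : 0 < l) :
    blockLabelling k g h (ω ^ (log ω k + l)) = g l := by
  rw [blockLabelling_of_lt] <;> rw [endLog_omega0_opow]
  · rw [add_sub_cancel]
  · exact lt_add_of_pos_right _ hl

theorem IsRealization.box_mem_blockLabelling_iff (hg : IsRealization τ r Ψ N (n + 1) w l g)
    {ξ : Ordinal.{u}} (hξ : log ω k < endLog ξ) (hξl : endLog ξ ≤ log ω k + l)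
    {φ : ModalFormula} : box n φ ∈ (blockLabelling k g h ξ).1 ↔ box n φ ∈ w.1 := by
  rw [blockLabelling_of_lt hξ]
  rcases (sub_le.2 hξl).lt_or_eq with hlt | heq
  · exact ((hg.rel _ (ordinal_sub_pos hξ) hlt).box_mem_iff n.lt_succ_self).symm
  · rw [heq, hg.endpoint]

theorem canonicalRel_blockLabelling (hk : k ≠ 0)
    (hg : ∀ ξ, 0 < ξ → ξ < l → CanonicalRel (n + 1) w (g ξ))
    (hh : ∀ ξ, 0 < ξ → ξ ≤ k → CanonicalRel n w (h ξ)) (hl : 0 < l) {ξ : Ordinal.{u}}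
    (h0 : 0 < ξ) (h1 : ξ < ω ^ (log ω k + l)) :
    CanonicalRel n w (blockLabelling k g h ξ) := by
  rcases lt_or_ge (log ω k) (endLog ξ) with hξ | hξ
  · rw [blockLabelling_of_lt hξ]
    exact (hg _ (ordinal_sub_pos hξ) (sub_lt_of_lt_add (endLog_lt h0.ne' h1) hl)).of_succ
  · obtain ⟨q, η, hη0, hηk, rfl⟩ := exists_mul_add_of_endLog_le hk h0.ne' hξ
    rw [blockLabelling_mul_add hη0 hηk]
    exact hh η hη0 hηk

namespace RankTower

variable {γ : Ordinal.{u}} {x : X}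

theorem succ_eq_endLog_sub (ht : RankTower b τ r) (hγx : γ < r n x) :
    r (n + 1) x = endLog (r n x - γ) := by
  rw [ht.succ_eq, ← endLog_add γ (Ordinal.sub_ne_zero_iff_lt.2 hγx),
    Ordinal.add_sub_cancel_of_le hγx.le]

theorem succ_le_of_le_add_omega0_opow (ht : RankTower b τ r) {β : Ordinal.{u}} (hγx : γ < r n x)
    (hx : r n x ≤ γ + ω ^ β) : r (n + 1) x ≤ β := by
  rw [ht.succ_eq_endLog_sub hγx, ← log_opow one_lt_omega0 β]
  exact endLog_le_log (Ordinal.sub_ne_zero_iff_lt.2 hγx) (sub_le.2 hx)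

-- Every neighborhood of `x` contains a point of successor rank `log ω k + 1`; there `τ n` has
-- the same neighborhoods as `b n`, so their images under `r n` contain whole blocks.
theorem exists_eq_add_mul_add (ht : RankTower b τ r) {U : Set X} (hU : IsOpen[τ n] U)
    (hxU : x ∈ U) (hγx : γ < r n x) (hk : k ≠ 0) (hkx : log ω k < r (n + 1) x) {η : Ordinal.{u}}
    (hη : η ≤ k) : ∃ y ∈ U, ∃ q, r n y = γ + (k * q + η) := by
  have hopen : IsOpen[τ n] (U ∩ {y | γ < r n y}) :=
    (τ n).isOpen_inter _ _ hU (ht.le_base le_rfl _ ((ht.dmap n).isOpen_gt γ))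
  obtain ⟨y, ⟨hyU, hγy : γ < r n y⟩, hy⟩ :=
    (ht.isRankFunction n).exists_rank_eq hopen ⟨hxU, hγx⟩ (succ_le_of_lt hkx)
  obtain ⟨V, hV, hyV, hVU⟩ :=
    ht.exists_isOpen_base hU hyU (by rw [hy]; exact not_isSuccLimit_succ _)
  obtain ⟨δ, hδ, hVδ⟩ := (ht.dmap n).open_map y V hV hyV (pos_of_gt hγy).ne'
  have hky : log ω k < endLog (r n y - γ) := by
    rw [← ht.succ_eq_endLog_sub hγy, hy]
    exact lt_succ _
  have hδy : δ - γ < r n y - γ :=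
    sub_lt_of_lt_add (by rwa [Ordinal.add_sub_cancel_of_le hγy.le])
      (ordinal_sub_pos hγy)
  obtain ⟨q, hδq, hqy⟩ := exists_mul_add_mem_Ioc hk hky hδy hη
  obtain ⟨z, hzV, hz⟩ := hVδ (γ + (k * q + η))
    ((le_add_sub δ γ).trans_lt (add_lt_add_right hδq γ))
    ((add_le_add_right hqy γ).trans_eq (Ordinal.add_sub_cancel_of_le hγy.le))
  exact ⟨z, hVU hzV, q, hz⟩

end RankTower

section BlockLabelling

variable {γ : Ordinal.{u}} {x : X} {m : ℕ}

theorem GoodLabelling.labelsAt_blockLabelling_of_le (ht : RankTower b τ r)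
    (hh : GoodLabelling τ r Ψ N n k h) (hk : k ≠ 0) (hγx : γ < r n x)
    (hx : r (n + 1) x ≤ log ω k) (hnm : n ≤ m) (hmN : m < N) :
    LabelsAt (τ m) Ψ m (fun y => blockLabelling k g h (r n y - γ)) x := by
  rw [ht.succ_eq_endLog_sub hγx] at hx
  obtain ⟨q, η, hη0, hηk, hxq⟩ :=
    exists_mul_add_of_endLog_le hk (Ordinal.sub_ne_zero_iff_lt.2 hγx) hx
  have hxη : r n x = γ + k * q + η := by
    rw [add_assoc, ← hxq, Ordinal.add_sub_cancel_of_le hγx.le]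
  have hqx : γ + k * q < r n x := hxη ▸ lt_add_of_pos_right _ hη0
  have hxk : r n x ≤ γ + k * q + k := hxη ▸ add_le_add_right hηk _
  refine (hh (γ + k * q) x hqx hxk m hnm hmN).congr
    (ht.le_base hnm _ ((ht.dmap n).isOpen_Ioc _ _)) ⟨hqx, hxk⟩ fun y ⟨hqy, hyk⟩ => ?_
  have hpos : 0 < r n y - (γ + k * q) := ordinal_sub_pos hqy
  have hy : r n y - γ = k * q + (r n y - (γ + k * q)) := by
    rw [← sub_sub, Ordinal.add_sub_cancel_of_le (lt_sub.2 hqy).le]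
  simp only [hy, blockLabelling_mul_add hpos (sub_le.2 hyk)]

theorem GoodLabelling.labelsAt_blockLabelling_of_lt (ht : RankTower b τ r)
    (hg : GoodLabelling τ r Ψ N (n + 1) l g) (hγx : γ < r n x)
    (hkx : log ω k < r (n + 1) x) (hxl : r (n + 1) x ≤ log ω k + l) (hnm : n < m) (hmN : m < N) :
    LabelsAt (τ m) Ψ m (fun y => blockLabelling k g h (r n y - γ)) x := by
  refine (hg (log ω k) x hkx hxl m hnm hmN).congr ((τ m).isOpen_inter _ _
    (ht.le_base hnm.le _ ((ht.dmap n).isOpen_gt γ))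
    (ht.le_base hnm _ ((ht.dmap (n + 1)).isOpen_gt (log ω k)))) ⟨hγx, hkx⟩ fun y ⟨hγy, hky⟩ => ?_
  have hy := ht.succ_eq_endLog_sub hγy
  rw [blockLabelling_of_lt (hky.trans_eq hy), ← hy]

theorem labelsAt_blockLabelling_self (ht : RankTower b τ r) (hk : k ≠ 0)
    (hg : IsRealization τ r Ψ N (n + 1) w l g)
    (hrel : ∀ ξ, 0 < ξ → ξ ≤ k → CanonicalRel n w (h ξ))
    (hrefute : ∀ ψ ∈ Ψ, box n ψ ∉ w.1 → ∃ ξ, 0 < ξ ∧ ξ ≤ k ∧ ψ ∉ (h ξ).1) (hγx : γ < r n x)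
    (hx : r n x ≤ γ + ω ^ (log ω k + l)) (hkx : log ω k < r (n + 1) x) :
    LabelsAt (τ n) Ψ n (fun y => blockLabelling k g h (r n y - γ)) x := by
  have hrx := ht.succ_eq_endLog_sub hγx
  have hxl : r (n + 1) x ≤ log ω k + l := ht.succ_le_of_le_add_omega0_opow hγx hx
  intro ψ hψ
  rw [hg.box_mem_blockLabelling_iff (hkx.trans_eq hrx) (hrx.symm.trans_le hxl)]
  constructor
  · intro hwψ
    obtain ⟨U, hU, hxU, hlt⟩ := (ht.isRankFunction n).lower x
    have hS := ht.le_base le_rfl _ ((ht.dmap n).isOpen_Ioc γ (γ + ω ^ (log ω k + l)))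
    refine notMem_derivOp_iff.2 ⟨_, (τ n).isOpen_inter _ _ hU hS, ⟨hxU, hγx, hx⟩,
      fun y ⟨hyU, hγy, hy⟩ hψy => of_not_not fun hne => hψy ?_⟩
    have hyl : r n y - γ < ω ^ (log ω k + l) := by
      refine (sub_le.2 hy).lt_of_ne fun e => (hlt y hyU hne).not_ge ?_
      rwa [ht.succ_eq_endLog_sub hγy, e, endLog_omega0_opow]
    exact (canonicalRel_blockLabelling hk hg.rel hrel hg.pos (ordinal_sub_pos hγy) hyl).mem hwψ
  · intro hxψ
    by_contra hwψ
    obtain ⟨η, hη0, hηk, hηψ⟩ := hrefute ψ hψ hwψ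
    refine hxψ (mem_derivOp_iff.2 fun U hU hxU => ?_)
    obtain ⟨y, hyU, q, hy⟩ := ht.exists_eq_add_mul_add hU hxU hγx hk hkx hηk
    refine ⟨y, hyU, ?_, ?_⟩
    · simpa only [Set.mem_ofPred_eq, hy, Ordinal.add_sub_cancel,
        blockLabelling_mul_add hη0 hηk] using hηψ
    · rintro rfl
      rw [hrx, hy, Ordinal.add_sub_cancel] at hkx
      exact hkx.not_ge (endLog_mul_add_le hη0 hηk)

theorem IsRealization.realizable_of_succ (hg : IsRealization τ r Ψ N (n + 1) w l g)
    (ht : RankTower b τ r) (hk0 : k ≠ 0) (hk : k < ε₀) (hh : GoodLabelling τ r Ψ N n k h)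
    (hrel : ∀ ξ, 0 < ξ → ξ ≤ k → CanonicalRel n w (h ξ))
    (hrefute : ∀ ψ ∈ Ψ, box n ψ ∉ w.1 → ∃ ξ, 0 < ξ ∧ ξ ≤ k ∧ ψ ∉ (h ξ).1) :
    Realizable τ r Ψ N n w := by
  have hlog : log ω k < ε₀ := (log_le_self ω k).trans_lt hk
  refine ⟨ω ^ (log ω k + l), blockLabelling k g h, opow_pos _ omega0_pos,
    omega0_opow_lt_epsilon_zero (add_lt_epsilon_zero hlog hg.lt_epsilon_zero),
    fun γ x hγx hx m hnm hmN => ?_, (blockLabelling_omega0_opow hg.pos).trans hg.endpoint,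
    fun ξ => canonicalRel_blockLabelling hk0 hg.rel hrel hg.pos⟩
  rcases le_or_gt (r (n + 1) x) (log ω k) with hxk | hkx
  · exact hh.labelsAt_blockLabelling_of_le ht hk0 hγx hxk hnm hmN
  rcases hnm.lt_or_eq with hlt | rfl
  · exact hg.good.labelsAt_blockLabelling_of_lt ht hγx hkx
      (ht.succ_le_of_le_add_omega0_opow hγx hx) hlt hmN
  · exact labelsAt_blockLabelling_self ht hk0 hg hrel hrefute hγx hx hkx

end BlockLabelling

theorem Realizable.of_forall_succ (ht : RankTower b τ r)
    (hsucc : ∀ w, Realizable τ r Ψ N (n + 1) w) (w : GLPWorld) : Realizable τ r Ψ N n w := by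
  classical
  induction hB : Ψ.filter fun ψ => box n ψ ∉ w.1 using Finset.strongInduction generalizing w with
  | H B ih =>
    obtain rfl | ⟨ψ₀, hψ₀⟩ := B.eq_empty_or_nonempty
    · refine realizable_of_forall_box_mem ht fun m hnm _ ψ hψ => w.2.box_of_le hnm ?_
      exact of_not_not (Finset.filter_eq_empty_iff.1 hB hψ)
    subst hB
    have hsuccessor : ∀ ψ ∈ Ψ.filter fun ψ => box n ψ ∉ w.1,
        ∃ v, CanonicalRel n w v ∧ ψ ∉ v.1 ∧ Realizable τ r Ψ N n v := by
      intro ψ hψ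
      obtain ⟨v, hwv, hψv, hψv'⟩ := exists_canonicalRel (Finset.mem_filter.1 hψ).2
      refine ⟨v, hwv, hψv', ih _ ?_ v rfl⟩
      exact (Finset.ssubset_iff_of_subset (Finset.monotone_filter_right Ψ
        fun χ _ hχ hχw => hχ (hwv.box_mem hχw))).2
          ⟨ψ, hψ, fun h => (Finset.mem_filter.1 h).2 hψv⟩
    obtain ⟨k, h, hk, hgood, hrel, hrefute⟩ :=
      exists_goodLabelling_of_forall_realizable ht _ hsuccessor
    obtain ⟨ξ, h0, h1, -⟩ := hrefute ψ₀ hψ₀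
    obtain ⟨l, g, hg⟩ := hsucc w
    exact hg.realizable_of_succ ht (h0.trans_le h1).ne' hk hgood hrel
      fun ψ hψ hψw => hrefute ψ (Finset.mem_filter.2 ⟨hψ, hψw⟩)

theorem realizable_of_le (ht : RankTower b τ r) (hn : n ≤ N) (w : GLPWorld) :
    Realizable τ r Ψ N n w := by
  induction hn using Nat.decreasingInduction generalizing w with
  | self => exact realizable_of_forall_box_mem ht fun m h1 h2 => absurd h2 h1.not_gt
  | of_succ n _ ih => exact Realizable.of_forall_succ ht ih w

end Labelling

/-! ### Soundness and completeness of GLP -/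

section TopologicalSemantics

open Ordinal ModalFormula

variable {X : Type u} {τ : ℕ → TopologicalSpace X} {v : ℕ → Set X} {φ ψ : ModalFormula}

theorem mem_value_imp {δ : ℕ → Set X → Set X} {x : X} :
    x ∈ (imp φ ψ).value δ v ↔ (x ∈ φ.value δ v → x ∈ ψ.value δ v) := by
  rw [imp_iff_not_or]
  rfl

theorem value_imp_eq_univ_iff {δ : ℕ → Set X → Set X} :
    (imp φ ψ).value δ v = Set.univ ↔ φ.value δ v ⊆ ψ.value δ v := by
  simp only [Set.eq_univ_iff_forall, mem_value_imp, Set.subset_def]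

theorem value_dia {δ : ℕ → Set X → Set X} {n : ℕ} :
    (dia n φ).value δ v = δ n (φ.value δ v) := by
  simp only [dia, neg, ModalFormula.value, Set.union_empty, compl_compl]

theorem GLP_subset_topLog (hτ : Antitone τ) (hscattered : ∀ n, IsScattered (τ n))
    (hopen : ∀ m n, m < n → ∀ A, IsOpen[τ n] (derivOp (τ m) A)) : GLP ⊆ topLog τ := by
  intro φ hφ v
  induction hφ with
  | taut h =>
    exact Set.eq_univ_of_forall fun x =>
      h (fun ψ => x ∈ ψ.value _ v) id fun _ _ => mem_value_imp
  | distr n φ ψ =>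
    refine value_imp_eq_univ_iff.2 fun x hi => mem_value_imp.2 fun hφ hψ => ?_
    have hsub : (ψ.value (fun n => derivOp (τ n)) v)ᶜ ⊆
        ((imp φ ψ).value (fun n => derivOp (τ n)) v)ᶜ ∪
          (φ.value (fun n => derivOp (τ n)) v)ᶜ := by
      intro y hψ
      by_contra hy
      simp only [Set.mem_union, not_or, Set.mem_compl_iff, not_not] at hy
      exact hψ (mem_value_imp.1 hy.1 hy.2)
    rcases (derivOp_union _ _ _).subset (derivOp_mono hsub hψ) with h | h
    · exact hi h
    · exact hφ h
  | loeb n φ =>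
    refine value_imp_eq_univ_iff.2 (Set.compl_subset_compl.2 ?_)
    have hcompl : ((imp (box n φ) φ).value (fun n => derivOp (τ n)) v)ᶜ =
        (φ.value (fun n => derivOp (τ n)) v)ᶜ \
          derivOp (τ n) (φ.value (fun n => derivOp (τ n)) v)ᶜ := by
      simp only [ModalFormula.value, compl_compl, Set.compl_union, Set.sdiff_eq, Set.inter_comm]
    rw [hcompl]
    exact ((hscattered n).derivOp_diff_derivOp _).ge
  | mono hmn φ =>
    exact value_imp_eq_univ_iff.2 (Set.compl_subset_compl.2 (derivOp_anti (hτ hmn.le) _))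
  | @negIntro m n hmn φ =>
    refine value_imp_eq_univ_iff.2 fun x hx => notMem_derivOp_iff.2 ⟨_, ?_, hx, fun y hy hny =>
      absurd hy hny⟩
    rw [value_dia]
    exact hopen m n hmn _
  | mp _ _ ihφ ihi => exact Set.univ_subset_iff.1 (ihφ ▸ value_imp_eq_univ_iff.1 ihi)
  | nec n _ ih => simp only [ModalFormula.value, ih, Set.compl_univ, derivOp_empty, Set.compl_empty]

/-- Every subformula `[m]ψ` of the given formula satisfies `m < N` and `ψ ∈ Ψ`. -/
def ModalFormula.BoxesIn (Ψ : Finset ModalFormula) (N : ℕ) : ModalFormula → Prop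
  | var _ => True
  | bot => True
  | imp φ ψ => φ.BoxesIn Ψ N ∧ ψ.BoxesIn Ψ N
  | box n φ => n < N ∧ φ ∈ Ψ ∧ φ.BoxesIn Ψ N

namespace ModalFormula

theorem BoxesIn.mono {Ψ Ψ' : Finset ModalFormula} {N N' : ℕ} (h : φ.BoxesIn Ψ N) (hΨ : Ψ ⊆ Ψ')
    (hN : N ≤ N') : φ.BoxesIn Ψ' N' := by
  induction φ with
  | var _ => trivial
  | bot => trivial
  | imp φ ψ ihφ ihψ => exact ⟨ihφ h.1, ihψ h.2⟩
  | box n φ ih => exact ⟨h.1.trans_le hN, hΨ h.2.1, ih h.2.2⟩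

theorem exists_boxesIn (φ : ModalFormula) : ∃ Ψ N, φ.BoxesIn Ψ N := by
  classical
  induction φ with
  | var _ => exact ⟨∅, 0, trivial⟩
  | bot => exact ⟨∅, 0, trivial⟩
  | imp φ ψ ihφ ihψ =>
    obtain ⟨Ψ, N, h⟩ := ihφ
    obtain ⟨Ψ', N', h'⟩ := ihψ
    exact ⟨Ψ ∪ Ψ', max N N', h.mono Finset.subset_union_left (le_max_left _ _),
      h'.mono Finset.subset_union_right (le_max_right _ _)⟩
  | box n φ ih =>
    obtain ⟨Ψ, N, h⟩ := ih
    exact ⟨insert φ Ψ, max N (n + 1), n.lt_succ_self.trans_le (le_max_right _ _),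
      Finset.mem_insert_self _ _, h.mono (Finset.subset_insert _ _) (le_max_left _ _)⟩

end ModalFormula

theorem mem_value_iff_mem_of_labelsAt {Ψ : Finset ModalFormula} {N : ℕ} {S : Set X}
    {F : X → GLPWorld} (hS : ∀ m < N, IsOpen[τ m] S)
    (hF : ∀ x ∈ S, ∀ m < N, LabelsAt (τ m) Ψ m F x) (hφ : φ.BoxesIn Ψ N) {x : X} (hx : x ∈ S) :
    x ∈ φ.value (fun n => derivOp (τ n)) (fun p => {y | var p ∈ (F y).1}) ↔ φ ∈ (F x).1 := by
  induction φ generalizing x with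
  | var p => exact Iff.rfl
  | bot => exact iff_of_false id (F x).2.bot_notMem
  | imp φ ψ ihφ ihψ => rw [mem_value_imp, (F x).2.imp_mem_iff, ihφ hφ.1 hx, ihψ hφ.2 hx]
  | box n φ ih =>
    rw [hF x hx n hφ.1 φ hφ.2.1]
    exact not_congr (mem_derivOp_congr (hS n hφ.1) hx fun y hy => not_congr (ih hφ.2.2 hy))

namespace IsLmeSpace

variable {τb : TopologicalSpace X} {r : X → Ordinal.{u}}

theorem GLP_subset_topLog (h : IsLmeSpace τb τ) (hr : IsOrdinalDMap τb r) : GLP ⊆ topLog τ :=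
  have ht := h.rankTower hr
  _root_.GLP_subset_topLog ht.antitone (fun n => (ht.isRankFunction n).isScattered)
    fun m _ hmn A => ht.le_base hmn _ (isOpen_plusTopology_derivOp (τ m) A)

theorem topLog_subset_GLP (h : IsLmeSpace τb τ) (hr : IsOrdinalDMap τb r)
    (hsurj : ∀ l < ε₀, ∃ x, r x = l) : topLog τ ⊆ GLP := by
  intro φ hφ
  by_contra hnot
  have ht := h.rankTower hr
  obtain ⟨w, hw⟩ := exists_world_of_not_provable hnot
  obtain ⟨Ψ, N, hΨ⟩ := φ.exists_boxesIn
  obtain ⟨l, f, hf⟩ := realizable_of_le (Ψ := Ψ) ht N.zero_le w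
  obtain ⟨x, rfl⟩ := hsurj l hf.lt_epsilon_zero
  have htruth := mem_value_iff_mem_of_labelsAt (x := x) (F := fun y => f (r y - 0))
    (fun m _ => ht.le_base m.zero_le _ (hr.isOpen_Ioc 0 (r x)))
    (fun y hy m hm => hf.good 0 y hy.1 (by simpa using hy.2) m m.zero_le hm) hΨ ⟨hf.pos, le_rfl⟩
  rw [hφ, Ordinal.sub_zero, hf.endpoint] at htruth
  exact hw (htruth.1 trivial)

end IsLmeSpace

end TopologicalSemantics

open scoped Ordinal in
theorem mainTheorem2_general {o : Ordinal.{u}} (ho : ε₀ ≤ o) :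
    (∃ τ : ℕ → TopologicalSpace o.ToType, IsOrdinalLmeSpace o τ) ∧
      ∀ τ : ℕ → TopologicalSpace o.ToType, IsOrdinalLmeSpace o τ → topLog τ = GLP := by
  have hr := isOrdinalDMap_toOrd o
  refine ⟨hr.isRankFunction.isScattered.exists_isLmeSpace, fun τ hτ => ?_⟩
  exact (IsLmeSpace.topLog_subset_GLP hτ hr fun l hl =>
    ⟨.mk ⟨l, hl.trans_le ho⟩, by simp⟩).antisymm (hτ.GLP_subset_topLog hr)

open scoped Ordinal in
theorem mainTheorem2 :
    ∃ τ : ℕ → TopologicalSpace (ε₀ : Ordinal.{0}).ToType,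
      IsOrdinalLmeSpace (ε₀ : Ordinal.{0}) τ ∧ topLog τ = GLP := by
  obtain ⟨⟨τ, hτ⟩, hlog⟩ := mainTheorem2_general (le_refl ε₀)
  exact ⟨τ, hτ, hlog τ hτ⟩
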